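/- Conventions. For a quasi-order $(Q,\le_Q)$ (a set), consider sets built over the elements of $Q$ as urelements. The rank of a set $x$ is the supremum of $\operatorname{rk}(y)+1$ over the elements $y\in x$ that are not urelements (so a set of urelements has rank $0$). $\dot V_\alpha(Q)$ consists of the urelements and of the sets of rank $<\alpha$ that have an urelement in their transitive closure. The quasi-order $\lesssim^*_Q$ is defined recursively: $x\lesssim^*_Q y$ iff $x\le_Q y$ for $x,y\in Q$; iff $\forall x'\in x\,\exists y'\in y\;(x'\lesssim^*_Q y')$ for sets $x,y$; and if exactly one of $x,y$ is an urelement $q$, it is replaced by $\{q\}$. Write $x\sim^*_Q y$ for $x\lesssim^*_Q y\lesssim^*_Q x$. By recursion on the ordinal $\alpha$, $$\dot I^*_\alpha(Q)=Q\cup\{x\in\dot V_\alpha(Q)\text{ a set}:\ \forall x'\in x\,\exists\beta<\alpha\,(x'\in\dot I^*_\beta(Q))\text{ and }\forall y,z\in x\,\exists w\in x\,(y,z\lesssim^*_Q w)\}.$$ If $(Q,\le_Q,\cdot)$ is moreover a monoid with neutral element $e$, put $x\cdot y=\{x'\cdot y':x'\in x,\,y'\in y\}$ for sets $x,y$, where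 an urelement $q$ multiplied with a set is again read as $\{q\}$. An element $x\in\dot I^*_\alpha(Q)$ is a *prime* of $\dot I^*_\alpha(Q)$ if $x\not\sim^*_Q e$ and, for all $a,b\in\dot I^*_\alpha(Q)$, $x\sim^*_Q a\cdot b$ implies $x\sim^*_Q a$ or $x\sim^*_Q b$; it is *idempotent* if $x\cdot x\sim^*_Q x$. For $X\subseteq\dot I^*_\alpha(Q)$ let $X^*$ be the set of all $a\in\dot I^*_\alpha(Q)$ that are $\sim^*_Q$-equivalent to a finite product of elements of $X$ (the empty product being $e$). For a quasi-order $P$, let $P^{<\omega}$ be the monoid of finite sequences over $P$ under concatenation, quasi-ordered by embeddability ($s\preceq t$ iff $s$ is pointwise $\le_P$ some subsequence of $t$), and identify $P$ with the sequences of length one, so that $\dot I^*_\alpha(P)\subseteq\dot I^*_\alpha(P^{<\omega})$. Define $S_0(P)=\emptyset$, $S_\lambda(P)=\bigcup_{\alpha<\lambda}S_\alpha(P)$ for limit $\lambda$, and $$S_{\alpha+1}(P)=S_\alpha(P)\cup\{X^*: X\text{ a non-empty, }\lesssim^*_{P^{<\omega}}\text{-downward-closed subset of }S_\alpha(P)\cup\dot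 I^*_\alpha(P)\},$$ where $X^*$ is formed in $\dot I^*_\alpha(P^{<\omega})$. A *front* is an infinite set $F$ of finite subsets of $\mathbb N$ (read as increasing sequences), no one of which is a proper initial segment of another, such that each infinite $X\subseteq\bigcup F$ has an initial segment in $F$, together with an ordinal-valued function $\mathrm{rk}_F$, strictly decreasing along proper initial segments, on the set of finite subsets of $\bigcup F$ that are proper initial segments of members of $F$; its rank is $\mathrm{rk}_F(\emptyset)$. For non-empty $\sigma,\tau$ write $\sigma\triangleleft\tau$ if $\min\sigma<\min\tau$ and one of $\sigma\setminus\{\min\sigma\}$, $\tau$ is an initial segment of the other. $P$ is a *$\zeta$-wqo* if it is well-founded and there is no map $f:F\to P$ from a front of rank $<\zeta$ with $f(\sigma)\not\le_P f(\tau)$ for all $\sigma\triangleleft\tau$ in $F$. **Theorem.** Let $\alpha$ be an ordinal and let $P$ be an $(\alpha+1)$-wqo. Then: 1. every element of $\dot I^*_\alpha(P)$ is a non-idempotent prime of $\dot I^*_\alpha(P^{<\omega})$; 2. every element of $S_\alpha(P)$ is an idempotent prime of $\dot I^*_\alpha(P^{<\omega})$; 3. every non-idempotent prime of $\dot I^*_\alpha(P^{<\omega})$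 is $\sim^*_{P^{<\omega}}$-equivalent to an element of $\dot I^*_\alpha(P)$; 4. every idempotent prime of $\dot I^*_\alpha(P^{<\omega})$ is $\sim^*_{P^{<\omega}}$-equivalent to an element of $S_\alpha(P)$. -/

import Mathlib

universe u

namespace IterIdeal

/-! ### Fronts, arrays and `α`-well quasi-orders

Finite subsets of `ℕ` play the role of finite strictly increasing sequences. -/

/-- `s` is an initial segment of `t` (both read as increasing sequences). -/
def InitSeg (s t : Set ℕ) : Prop :=
  s ⊆ t ∧ ∀ a ∈ t, ∀ b ∈ s, a ≤ b → a ∈ s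

/-- The base `⋃ F`. -/
def base (F : Set (Finset ℕ)) : Set ℕ := {n | ∃ s ∈ F, n ∈ s}

/-- The set `T_F` of finite subsets of `⋃ F` that are proper initial segments of a member of `F`. -/
def frontTree (F : Set (Finset ℕ)) : Set (Finset ℕ) :=
  {s | (s : Set ℕ) ⊆ base F ∧ ∃ t ∈ F, InitSeg s t ∧ s ≠ t}

/-- `(F, rk)` is a front: an infinite antichain for `InitSeg` that has an initial segment of each
infinite subset of its base, with a rank function on `frontTree F`
(the values of `rk` outside `frontTree F` are irrelevant). -/
structure IsFront (F : Set (Finset ℕ)) (rk : Finset ℕ → Ordinal.{u}) : Prop where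
  infinite : F.Infinite
  antichain : ∀ s ∈ F, ∀ t ∈ F, InitSeg s t → s = t
  bar : ∀ X : Set ℕ, X ⊆ base F → X.Infinite → ∃ s ∈ F, InitSeg s X
  rk_lt : ∀ s ∈ frontTree F, ∀ t ∈ frontTree F, InitSeg s t → s ≠ t → rk t < rk s

/-- The relation `s ◁ t`: `min s < min t`, and `s \ {min s}` and `t` are comparable. -/
def Tri (s t : Finset ℕ) : Prop :=
  ∃ (hs : s.Nonempty) (ht : t.Nonempty), s.min' hs < t.min' ht ∧
    (InitSeg (s.erase (s.min' hs)) t ∨ InitSeg t (s.erase (s.min' hs)))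

/-- An array `f` on `F` is bad if `f s ≰ f t` whenever `s ◁ t`. -/
def BadArray {Q : Type u} [Preorder Q] (F : Set (Finset ℕ)) (f : F → Q) : Prop :=
  ∀ s t : F, Tri s t → ¬ f s ≤ f t

/-- `Q` is an `α`-well quasi-order: it is well-founded and has no bad array of rank `< α`. -/
def IsAlphaWqo (Q : Type u) [Preorder Q] (α : Ordinal.{u}) : Prop :=
  (∀ A : Set Q, A.Nonempty → ∃ m ∈ A, ∀ a ∈ A, ¬ a < m) ∧
  ¬ ∃ (F : Set (Finset ℕ)) (rk : Finset ℕ → Ordinal.{u}) (f : F → Q),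
      IsFront F rk ∧ rk ∅ < α ∧ BadArray F f

/-! ### Finite sequences -/

/-- Finite sequences over `P`. -/
def FinSeq (P : Type u) : Type u := List P

/-- Concatenation; the neutral element is the empty sequence. -/
instance (P : Type u) : Monoid (FinSeq P) := inferInstanceAs (Monoid (FreeMonoid P))

/-- The embeddability order: `s ≤ t` iff `s` is pointwise below some subsequence of `t`. -/
instance (P : Type u) [Preorder P] : Preorder (FinSeq P) where
  le s t := List.SublistForall₂ (fun a b : P => a ≤ b) s t
  le_refl s := refl_of (List.SublistForall₂ (fun a b : P => a ≤ b)) s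
  le_trans s t r hst htr := trans_of (List.SublistForall₂ (fun a b : P => a ≤ b)) hst htr

/-- The sequence of length one. -/
def FinSeq.single {P : Type u} (p : P) : FinSeq P := [p]

/-! ### The universe of sets over the urelements `Q` -/

/-- Sets with urelements from `Q`. As with Mathlib's `PSet`, a set is given by an indexed family of
its elements, and `ExtEq` is equality of the sets so described. -/
inductive V (Q : Type u) : Type (u + 1)
  | ur (q : Q) : V Q
  | set (ι : Type u) (f : ι → V Q) : V Q

namespace V

variable {Q R : Type u}

/-- Extensional equality. -/
def ExtEq : V Q → V Q → Prop
  | ur p, ur q => p = q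
  | ur _, set _ _ => False
  | set _ _, ur _ => False
  | set _ f, set _ g => (∀ i, ∃ j, ExtEq (f i) (g j)) ∧ (∀ j, ∃ i, ExtEq (f i) (g j))

/-- Membership `y ∈ x`; urelements have no elements. -/
def Mem (y : V Q) : V Q → Prop
  | ur _ => False
  | set _ f => ∃ i, ExtEq y (f i)

/-- `x` is an urelement or has an urelement in its transitive closure. -/
def HasUr : V Q → Prop
  | ur _ => True
  | set _ f => ∃ i, HasUr (f i)

/-- `x` is an urelement. -/
def IsUr (x : V Q) : Prop := ∃ q, x = ur q

open Classical in
/-- The rank of a set: the supremum of `rank y + 1` over its elements `y` that are sets.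
(The rank of an urelement is undefined; `0` is a dummy value.) -/
noncomputable def rank : V Q → Ordinal.{u}
  | ur _ => 0
  | set _ f => ⨆ i, if IsUr (f i) then 0 else rank (f i) + 1

/-- The class `V̇_α(Q)`. -/
def dotV (Q : Type u) (α : Ordinal.{u}) : Set (V Q) :=
  {x | IsUr x ∨ (HasUr x ∧ rank x < α)}

/-- Replace each urelement `q` by `φ q`, hereditarily. -/
def map (φ : Q → R) : V Q → V R
  | ur q => ur (φ q)
  | set ι f => set ι fun i => map φ (f i)

/-- `p ≲* y` for an urelement `p`: it is `p ≤ q` if `y = q` is an urelement, and `{p} ≲* y`, that is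
`∃ y' ∈ y, p ≲* y'`, if `y` is a set. -/
def urLe [Preorder Q] (p : Q) : V Q → Prop
  | ur q => p ≤ q
  | set _ g => ∃ j, urLe p (g j)

/-- The quasi-order `x ≲* y`. If `x` is a set and `y` an urelement, it is `x ≲* {y}`, that is
`∀ x' ∈ x, x' ≲* y`. -/
def Le [Preorder Q] : V Q → V Q → Prop
  | ur p, y => urLe p y
  | set _ f, ur q => ∀ i, Le (f i) (ur q)
  | set _ f, set _ g => ∀ i, ∃ j, Le (f i) (g j)

/-- The equivalence relation `x ∼* y` induced by `≲*`. -/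
def Sim [Preorder Q] (x y : V Q) : Prop := Le x y ∧ Le y x

/-- The product `p · y = {p} · y` for an urelement `p`. -/
def urMul [Monoid Q] (p : Q) : V Q → V Q
  | ur q => ur (p * q)
  | set κ g => set κ fun j => urMul p (g j)

/-- The product: `x · y = {x' · y' : x' ∈ x, y' ∈ y}` for sets `x`, `y`, extending that of `Q`, where
an urelement `q` multiplied with a set is read as `{q}`. -/
def mul [Monoid Q] : V Q → V Q → V Q
  | ur p, y => urMul p y
  | set ι f, ur q => set ι fun i => mul (f i) (ur q)
  | set ι f, set κ g => set (ι × κ) fun k => mul (f k.1) (g k.2)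

/-- Finite products; the empty product is the neutral element. -/
def listProd [Monoid Q] (l : List (V Q)) : V Q := l.foldr mul (ur 1)

end V

open V

/-! ### Iterated ideals -/

/-- The class `İ*_α(Q)`: the urelements, and the elements of `V̇_α(Q)` all of whose elements lie in
some `İ*_β(Q)`, `β < α`, and which are upward-directed with respect to `≲*`. -/
def iterIdeal (Q : Type u) [Preorder Q] (α : Ordinal.{u}) : Set (V Q) :=
  {x | IsUr x ∨ ∃ (ι : Type u) (f : ι → V Q), x = V.set ι f ∧ x ∈ dotV Q α ∧
    (∀ i, ∃ (β : Ordinal.{u}) (_ : β < α), f i ∈ iterIdeal Q β) ∧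
    ∀ i j, ∃ k, Le (f i) (f k) ∧ Le (f j) (f k)}
termination_by α

/-- `x` is a prime of `İ*_α(Q)`: it is not equivalent to the identity, and `x ∼* a · b` implies
`x ∼* a` or `x ∼* b`. -/
def IsPrimeIn {Q : Type u} [Preorder Q] [Monoid Q] (α : Ordinal.{u}) (x : V Q) : Prop :=
  x ∈ iterIdeal Q α ∧ ¬ Sim x (ur 1) ∧
    ∀ a ∈ iterIdeal Q α, ∀ b ∈ iterIdeal Q α, Sim x (mul a b) → Sim x a ∨ Sim x b

/-- `x` is idempotent: `x · x ∼* x`. -/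
def IsIdem {Q : Type u} [Preorder Q] [Monoid Q] (x : V Q) : Prop := Sim (mul x x) x

/-- The non-empty downward-closed subclasses of `C`, with respect to `≲*`. -/
def dotD {Q : Type u} [Preorder Q] (C : Set (V Q)) : Set (Set (V Q)) :=
  {X | X.Nonempty ∧ X ⊆ C ∧ ∀ y ∈ X, ∀ z ∈ C, Le z y → z ∈ X}

/-- `X^*` for `X ⊆ İ*_α(Q)`: the elements of `İ*_α(Q)` equivalent to a finite product of elements
of `X`. -/
def star {Q : Type u} [Preorder Q] [Monoid Q] (α : Ordinal.{u}) (X : Set (V Q)) : Set (V Q) :=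
  {a | a ∈ iterIdeal Q α ∧ ∃ l : List (V Q), (∀ b ∈ l, b ∈ X) ∧ Sim a (listProd l)}

/-- `İ*_α(P)` inside `İ*_α(P^{<ω})`, where `P` is identified with the sequences of length one. -/
def idealsOf (P : Type u) [Preorder P] (α : Ordinal.{u}) : Set (V (FinSeq P)) :=
  V.map FinSeq.single '' iterIdeal P α

/-- The hierarchy `S_α(P)`: `S_0 = ∅`, `S_{β+1} = S_β ∪ {X^* : X ∈ Ḋ(S_β ∪ İ*_β(P))}`, and unions at
limits. -/
noncomputable def starHier (P : Type u) [Preorder P] (α : Ordinal.{u}) : Set (V (FinSeq P)) :=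
  Ordinal.limitRecOn (motive := fun _ => Set (V (FinSeq P))) α ∅
    (fun β S => S ∪ {x | ∃ X ∈ dotD (S ∪ idealsOf P β), ∀ y, Mem y x ↔ y ∈ star β X})
    (fun lam _ S => {x | ∃ (β : Ordinal.{u}) (hβ : β < lam), x ∈ S β hβ})

end IterIdeal

/-! Call the elements of `S_α(P)` and of `İ*_α(P)` atoms. That atoms are primes is elementary. For
words, `c * d ≤ a * b` forces `c ≤ a` or `d ≤ b`, and this lifts to sets
(`V.le_or_le_of_mul_le_mul`). If `x` is a star, witnesses against `x ≲* a` and `x ≲* b` multiply to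
a further element of `x`, so `x` cannot lie below `a · b`. If `x` comes from `İ*_α(P)`, two
witnesses have a common upper bound in `x`. Stars are idempotent because they are closed under
products. Elements of `İ*_α(P)` are not, since they contain only words of length one.

Conversely, every element of `İ*_α(P^{<ω})` is equivalent to a finite product of atoms
(`exists_sim_listProd`); a prime is then equivalent to one of its factors, and idempotency tells
which kind of atom this is. The factorization goes by induction on the level. The elements of a set
are, by induction, products of atoms of some lower level `β`, and by directedness they generate an
ideal `D` in the monoid of words over these atoms. If `D` is closed under products, it is
represented by a star or by `1`. Otherwise it decomposes as `F · G · H`, with smaller ideals `F` and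
`H` and an ideal `G` of single atoms (`ideal_induction`). The ideal `G` becomes an atom of level `β
+ 1`, or the product `1`, and well-founded induction on ideals finishes the argument.

That induction needs the atoms of level `β` to be well quasi-ordered (`exists_le_of_atoms`), and
this is where the hypothesis on `P` enters. An atom is coded as a set of depth at most `β` over `P`
with one isolated mark added for stars. A bad sequence of codes yields a tree of successively chosen
elements, whose leaves are indexed by a front of rank `β`. A partition argument makes the leaves all
lie in `P`, which gives a bad array, or all equal the mark, which is absurd. -/

namespace IterIdeal

/-! ### Finite sequences as an ordered monoid -/

namespace FinSeq

variable {P : Type u}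

theorem mul_eq_append (s t : FinSeq P) : s * t = (show List P from s) ++ (show List P from t) := rfl

variable [Preorder P]

theorem le_iff {s t : FinSeq P} :
    s ≤ t ↔ ∃ l : List P, List.Forall₂ (· ≤ ·) s l ∧ List.Sublist l t :=
  List.sublistForall₂_iff

protected theorem one_le (s : FinSeq P) : 1 ≤ s := List.SublistForall₂.nil

protected theorem mul_le_mul {a b c d : FinSeq P} (h : a ≤ c) (h' : b ≤ d) : a * b ≤ c * d := by
  rw [le_iff] at *
  obtain ⟨l, hl, hs⟩ := h
  obtain ⟨m, hm, ht⟩ := h'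
  exact ⟨l ++ m, List.rel_append hl hm, hs.append ht⟩

/-- An embedding sends an initial part of `c * d` into `a` and the rest into `b`. If the cut is not
before the end of `c`, then `c` goes into `a`; otherwise `d` goes into `b`. -/
theorem le_or_le_of_mul_le_mul {a b c d : FinSeq P} (h : c * d ≤ a * b) : c ≤ a ∨ d ≤ b := by
  obtain ⟨l, hl, hs⟩ := le_iff.1 h
  rw [mul_eq_append] at hl hs
  obtain ⟨m₁, m₂, rfl, h₁, h₂⟩ := List.sublist_append_iff.1 hs
  have hc := (List.forall₂_take_append _ _ _ hl.flip).flip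
  have hd := (List.forall₂_drop_append _ _ _ hl.flip).flip
  rcases le_total (List.length c) m₁.length with hlen | hlen
  · left
    refine le_iff.2 ⟨_, hc, ?_⟩
    rw [List.take_append_of_le_length hlen]
    exact (List.take_sublist _ _).trans h₁
  · right
    refine le_iff.2 ⟨_, hd, ?_⟩
    rw [List.drop_append, List.drop_eq_nil_of_le hlen, List.nil_append]
    exact (List.drop_sublist _ _).trans h₂

theorem single_le_iff {p : P} {s : FinSeq P} :
    single p ≤ s ↔ ∃ q ∈ (show List P from s), p ≤ q := by
  rw [le_iff]
  constructor
  · rintro ⟨l, hl, hs⟩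
    obtain ⟨q, l', hq, hl', rfl⟩ := List.forall₂_cons_left_iff.1 hl
    exact ⟨q, hs.subset (by simp), hq⟩
  · rintro ⟨q, hq, hpq⟩
    exact ⟨[q], .cons hpq .nil, List.singleton_sublist.2 hq⟩

theorem single_le_single {p q : P} : single p ≤ single q ↔ p ≤ q := by
  rw [single_le_iff]
  constructor
  · rintro ⟨r, hr, h⟩
    rwa [List.mem_singleton.1 hr] at h
  · exact fun h => ⟨q, List.mem_singleton.2 rfl, h⟩

theorem single_le_mul {p : P} {s t : FinSeq P} (h : single p ≤ s * t) :
    single p ≤ s ∨ single p ≤ t := by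
  obtain ⟨q, hq, hpq⟩ := single_le_iff.1 h
  rcases List.mem_append.1 hq with hq | hq
  · exact .inl (single_le_iff.2 ⟨q, hq, hpq⟩)
  · exact .inr (single_le_iff.2 ⟨q, hq, hpq⟩)

theorem not_single_le_one (p : P) : ¬ single p ≤ 1 := by
  rw [single_le_iff]
  rintro ⟨q, hq, -⟩
  exact List.not_mem_nil hq

theorem not_single_mul_single_le (p p' q : P) : ¬ single p * single p' ≤ single q := by
  intro h
  obtain ⟨l, hl, hs⟩ := le_iff.1 h
  have h₁ := hl.length_eq
  have h₂ := hs.length_le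
  have h₃ : List.length (single p * single p' : FinSeq P) = 2 := rfl
  have h₄ : List.length (single q) = 1 := rfl
  omega

end FinSeq

namespace V

/-! ### Elements, with an urelement read as its own singleton -/

section elements

variable {Q R : Type u}

/-- Index type of the elements of `x`, an urelement `q` being read as `{q}`. -/
def Idx : V Q → Type u
  | ur _ => PUnit
  | set ι _ => ι

/-- The elements of `x`, an urelement `q` being read as `{q}`. -/
def el : (x : V Q) → x.Idx → V Q
  | ur q, _ => ur q
  | set _ f, i => f i

/-- The successor of the rank for sets, and `0` for urelements. -/
noncomputable def depth : V Q → Ordinal.{u}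
  | ur _ => 0
  | set _ f => Order.succ (⨆ i, depth (f i))

theorem isUr_ur (q : Q) : IsUr (ur q) := ⟨q, rfl⟩

theorem not_isUr_set {ι : Type u} (f : ι → V Q) : ¬ IsUr (set ι f) := by
  rintro ⟨q, h⟩
  cases h

theorem depth_eq_zero_iff {x : V Q} : depth x = 0 ↔ IsUr x := by
  cases x with
  | ur q => simp [depth, isUr_ur]
  | set ι f => simp [depth, not_isUr_set]

theorem depth_lt_depth_set {ι : Type u} (f : ι → V Q) (i : ι) : depth (f i) < depth (set ι f) := by
  rw [depth, Order.lt_succ_iff]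
  exact Ordinal.le_iSup (fun i => depth (f i)) i

theorem depth_eq_succ_rank {x : V Q} (h : ¬ IsUr x) : depth x = Order.succ (rank x) := by
  induction x with
  | ur q => exact absurd (isUr_ur q) h
  | set ι f ih =>
    rw [depth, rank]
    congr 2
    funext i
    split_ifs with hi
    · exact depth_eq_zero_iff.2 hi
    · rw [ih i hi]; rfl

/-- With `depth`, the rank bound in `V̇_α` becomes a single inequality that urelements satisfy
automatically. -/
theorem depth_le_iff_rank {x : V Q} {α : Ordinal.{u}} : depth x ≤ α ↔ IsUr x ∨ rank x < α := by
  by_cases h : IsUr x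
  · simp [h, depth_eq_zero_iff.2 h]
  · simp [h, depth_eq_succ_rank h]

theorem depth_le_iff {x : V Q} {γ : Ordinal.{u}} (hγ : 0 < γ) :
    depth x ≤ γ ↔ ∃ δ < γ, ∀ i, depth (x.el i) ≤ δ := by
  cases x with
  | ur q => simpa [depth, el, Idx] using ⟨0, hγ⟩
  | set ι f =>
    rw [depth, Order.succ_le_iff]
    exact ⟨fun h => ⟨_, h, fun i => Ordinal.le_iSup (fun i => depth (f i)) i⟩,
      fun ⟨δ, hδ, h⟩ => (Ordinal.iSup_le h).trans_lt hδ⟩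

theorem depth_le_succ_iff {x : V Q} {γ : Ordinal.{u}} :
    depth x ≤ Order.succ γ ↔ ∀ i, depth (x.el i) ≤ γ := by
  rw [depth_le_iff (Order.bot_lt_succ γ)]
  exact ⟨fun ⟨δ, hδ, h⟩ i => (h i).trans (Order.lt_succ_iff.1 hδ),
    fun h => ⟨γ, Order.lt_succ γ, h⟩⟩

theorem depth_el_lt {x : V Q} {γ : Ordinal.{u}} (hγ : 0 < γ) (h : depth x ≤ γ) (i : x.Idx) :
    depth (x.el i) < γ := by
  obtain ⟨δ, hδ, h⟩ := (depth_le_iff hγ).1 h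
  exact (h i).trans_lt hδ

end elements

section induction

variable {Q₁ Q₂ Q₃ Q₄ : Type u}

/-- Induction on four arguments, all of which are replaced by elements simultaneously. -/
theorem induction₄ {motive : V Q₁ → V Q₂ → V Q₃ → V Q₄ → Prop}
    (base : ∀ p q r s, motive (ur p) (ur q) (ur r) (ur s))
    (step : ∀ x y z w, (∀ i j k l, motive (x.el i) (y.el j) (z.el k) (w.el l)) → motive x y z w)
    (x y z w) : motive x y z w := by
  -- An urelement is its own element, so passing to elements need not decrease each argument. A
  -- common bound on the depths does decrease: if it is positive, all elements, including
  -- urelements, lie strictly below it.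
  suffices ∀ γ : Ordinal.{u}, ∀ x y z w, depth x ≤ γ → depth y ≤ γ → depth z ≤ γ → depth w ≤ γ →
      motive x y z w from
    this (max (max (depth x) (depth y)) (max (depth z) (depth w))) x y z w (by simp) (by simp)
      (by simp) (by simp)
  intro γ
  induction γ using WellFoundedLT.induction with
  | ind γ ih =>
  intro x y z w hx hy hz hw
  rcases eq_or_ne γ 0 with rfl | hγ
  · obtain ⟨p, rfl⟩ := depth_eq_zero_iff.1 (le_antisymm hx zero_le)
    obtain ⟨q, rfl⟩ := depth_eq_zero_iff.1 (le_antisymm hy zero_le)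
    obtain ⟨r, rfl⟩ := depth_eq_zero_iff.1 (le_antisymm hz zero_le)
    obtain ⟨s, rfl⟩ := depth_eq_zero_iff.1 (le_antisymm hw zero_le)
    exact base p q r s
  · have hγ : 0 < γ := pos_iff_ne_zero.2 hγ
    refine step x y z w fun i j k l => ?_
    refine ih (max (max (depth (x.el i)) (depth (y.el j))) (max (depth (z.el k)) (depth (w.el l))))
      ?_ _ _ _ _ (by simp) (by simp) (by simp) (by simp)
    exact max_lt (max_lt (depth_el_lt hγ hx i) (depth_el_lt hγ hy j))
      (max_lt (depth_el_lt hγ hz k) (depth_el_lt hγ hw l))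

theorem induction₃ {motive : V Q₁ → V Q₂ → V Q₃ → Prop}
    (base : ∀ p q r, motive (ur p) (ur q) (ur r))
    (step : ∀ x y z, (∀ i j k, motive (x.el i) (y.el j) (z.el k)) → motive x y z)
    (x y z) : motive x y z := by
  refine induction₄ (Q₄ := PUnit) (motive := fun x y z w => IsUr w → motive x y z)
    (fun p q r _ _ => base p q r) ?_ x y z (ur ⟨⟩) (isUr_ur _)
  rintro x y z _ h ⟨s, rfl⟩
  exact step x y z fun i j k => h i j k PUnit.unit (isUr_ur s)

theorem induction₂ {motive : V Q₁ → V Q₂ → Prop}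
    (base : ∀ p q, motive (ur p) (ur q))
    (step : ∀ x y, (∀ i j, motive (x.el i) (y.el j)) → motive x y)
    (x y) : motive x y := by
  refine induction₃ (Q₃ := PUnit) (motive := fun x y z => IsUr z → motive x y)
    (fun p q _ _ => base p q) ?_ x y (ur ⟨⟩) (isUr_ur _)
  rintro x y _ h ⟨s, rfl⟩
  exact step x y fun i j => h i j PUnit.unit (isUr_ur s)

theorem el_induction {motive : V Q₁ → Prop} (base : ∀ p, motive (ur p))
    (step : ∀ x, (∀ i, motive (x.el i)) → motive x) (x) : motive x := by
  induction x with
  | ur q => exact base q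
  | set ι f ih => exact step _ ih

end induction

/-! ### The quasi-order -/

section order

variable {Q R : Type u} [Preorder Q] [Preorder R]

@[simp] theorem le_ur_ur {p q : Q} : Le (ur p) (ur q) ↔ p ≤ q := by simp [Le, urLe]

/-- Reading urelements as singletons merges all cases of the definition into one; later inductions
use only this form. -/
theorem le_iff {x y : V Q} : Le x y ↔ ∀ i, ∃ j, Le (x.el i) (y.el j) := by
  cases x <;> cases y <;> simp [Le, urLe, el, Idx]

theorem le_refl (x : V Q) : Le x x :=
  el_induction (motive := fun x => Le x x) (fun _ => le_ur_ur.2 le_rfl)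
    (fun _ h => le_iff.2 fun i => ⟨i, h i⟩) x

theorem le_trans {x y z : V Q} : Le x y → Le y z → Le x z := by
  refine induction₃ (motive := fun x y z : V Q => Le x y → Le y z → Le x z) ?_ ?_ x y z
  · intro p q r
    simpa using _root_.le_trans
  · intro x y z ih h h'
    rw [le_iff] at h h' ⊢
    intro i
    obtain ⟨j, hj⟩ := h i
    obtain ⟨k, hk⟩ := h' j
    exact ⟨k, ih i j k hj hk⟩

theorem el_le (x : V Q) (i : x.Idx) : Le (x.el i) x := by
  induction x with
  | ur q => exact le_refl _
  | set ι f ih =>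
    refine le_iff.2 fun k => ⟨i, ih i k⟩

theorem Sim.refl (x : V Q) : Sim x x := ⟨le_refl x, le_refl x⟩

theorem Sim.symm {x y : V Q} (h : Sim x y) : Sim y x := ⟨h.2, h.1⟩

theorem Sim.trans {x y z : V Q} (h : Sim x y) (h' : Sim y z) : Sim x z :=
  ⟨le_trans h.1 h'.1, le_trans h'.2 h.2⟩

end order

/-! ### Extensional equality -/

section extEq

variable {Q : Type u}

theorem ExtEq.refl (x : V Q) : ExtEq x x := by
  induction x with
  | ur q => simp [ExtEq]
  | set ι f ih => exact ⟨fun i => ⟨i, ih i⟩, fun i => ⟨i, ih i⟩⟩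

theorem ExtEq.symm {x y : V Q} (h : ExtEq x y) : ExtEq y x := by
  induction x generalizing y with
  | ur q => cases y <;> simp_all [ExtEq]
  | set ι f ih =>
    cases y with
    | ur q => simp [ExtEq] at h
    | set κ g =>
      refine ⟨fun j => ?_, fun i => ?_⟩
      · obtain ⟨i, hi⟩ := h.2 j
        exact ⟨i, ih i hi⟩
      · obtain ⟨j, hj⟩ := h.1 i
        exact ⟨j, ih i hj⟩

theorem ExtEq.trans {x y z : V Q} (h : ExtEq x y) (h' : ExtEq y z) : ExtEq x z := by
  induction x generalizing y z with
  | ur q => cases y <;> cases z <;> simp_all [ExtEq]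
  | set ι f ih =>
    cases y with
    | ur q => simp [ExtEq] at h
    | set κ g =>
      cases z with
      | ur q => simp [ExtEq] at h'
      | set l k =>
        refine ⟨fun i => ?_, fun m => ?_⟩
        · obtain ⟨j, hj⟩ := h.1 i
          obtain ⟨m, hm⟩ := h'.1 j
          exact ⟨m, ih i hj hm⟩
        · obtain ⟨j, hj⟩ := h'.2 m
          obtain ⟨i, hi⟩ := h.2 j
          exact ⟨i, ih i hi hj⟩

theorem ExtEq.exists_el {x y : V Q} (h : ExtEq x y) (i : x.Idx) :
    ∃ j, ExtEq (x.el i) (y.el j) := by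
  cases x with
  | ur q => cases y with
    | ur r => exact ⟨PUnit.unit, h⟩
    | set κ g => exact h.elim
  | set ι f => cases y with
    | ur r => exact h.elim
    | set κ g => exact h.1 i

theorem ExtEq.le [Preorder Q] {x y : V Q} : ExtEq x y → Le x y := by
  refine induction₂ (motive := fun x y : V Q => ExtEq x y → Le x y) ?_ ?_ x y
  · rintro p q rfl
    exact le_refl _
  · intro x y ih h
    refine le_iff.2 fun i => ?_
    obtain ⟨j, hj⟩ := h.exists_el i
    exact ⟨j, ih i j hj⟩

theorem ExtEq.sim [Preorder Q] {x y : V Q} (h : ExtEq x y) : Sim x y := ⟨h.le, h.symm.le⟩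

theorem ExtEq.depth_le {x y : V Q} (h : ExtEq x y) : depth x ≤ depth y := by
  induction x generalizing y with
  | ur q => simp [depth]
  | set ι f ih =>
    cases y with
    | ur q => exact h.elim
    | set κ g =>
      rw [depth, Order.succ_le_iff, depth, Order.lt_succ_iff]
      refine Ordinal.iSup_le fun i => ?_
      obtain ⟨j, hj⟩ := h.1 i
      exact (ih i hj).trans (Ordinal.le_iSup (fun j => depth (g j)) j)

/-- Up to extensional equality, there are only `u`-small many `x` of bounded depth. -/
theorem exists_small_cover (Q : Type u) (γ : Ordinal.{u}) :
    ∃ (κ : Type u) (g : κ → V Q), ∀ x : V Q, depth x ≤ γ → ∃ k, ExtEq x (g k) := by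
  induction γ using WellFoundedLT.induction with
  | ind γ ih =>
  choose κ g hg using ih
  let e := fun δ : γ.ToType => (Ordinal.ToType.mk (o := γ)).symm δ
  -- A set of depth at most `γ` is determined by some `δ < γ` and the set of those representatives
  -- of level `δ` that occur in it.
  refine ⟨Q ⊕ Σ δ : γ.ToType, Set (κ (e δ).1 (e δ).2),
    Sum.elim ur fun s => set s.2 fun k => g (e s.1).1 (e s.1).2 k, fun x hx => ?_⟩
  cases x with
  | ur q => exact ⟨.inl q, rfl⟩
  | set ι f =>
    have hγ : 0 < γ := (zero_le.trans_lt (Order.lt_succ _)).trans_le hx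
    obtain ⟨δ, hδ, hf⟩ := (depth_le_iff hγ).1 hx
    obtain ⟨d, hd⟩ : ∃ d, e d = ⟨δ, hδ⟩ := ⟨Ordinal.ToType.mk ⟨δ, hδ⟩, by simp [e]⟩
    obtain rfl : δ = (e d).1 := by rw [hd]
    refine ⟨.inr ⟨d, {k | ∃ i, ExtEq (f i) (g _ (e d).2 k)}⟩, fun i => ?_, fun k => k.2⟩
    obtain ⟨k, hk⟩ := hg _ (e d).2 (f i) (hf i)
    exact ⟨⟨k, i, hk⟩, hk⟩

/-- A class of elements of bounded depth is, up to extensional equality, a small family. -/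
theorem exists_small_family {C : Set (V Q)} {γ : Ordinal.{u}} (hC : ∀ x ∈ C, depth x ≤ γ) :
    ∃ (ι : Type u) (f : ι → V Q), (∀ i, f i ∈ C) ∧ ∀ x ∈ C, ∃ i, ExtEq x (f i) := by
  obtain ⟨κ, g, hg⟩ := exists_small_cover Q γ
  choose f hf hfg using fun k : {k : κ // ∃ x ∈ C, ExtEq x (g k)} => k.2
  refine ⟨_, f, hf, fun x hx => ?_⟩
  obtain ⟨k, hk⟩ := hg x (hC x hx)
  exact ⟨⟨k, x, hx, hk⟩, hk.trans (hfg ⟨k, x, hx, hk⟩).symm⟩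

end extEq

/-! ### Multiplication -/

section mul

variable {Q : Type u} [Monoid Q]

theorem mul_ur_ur (p q : Q) : mul (ur p) (ur q) = ur (p * q) := rfl

theorem exists_el_mul (x y : V Q) (i : x.Idx) (j : y.Idx) :
    ∃ k, (mul x y).el k = mul (x.el i) (y.el j) := by
  cases x with
  | ur p => cases y with
    | ur q => exact ⟨PUnit.unit, rfl⟩
    | set κ g => exact ⟨j, rfl⟩
  | set ι f => cases y with
    | ur q => exact ⟨i, rfl⟩
    | set κ g => exact ⟨(i, j), rfl⟩

theorem exists_of_el_mul (x y : V Q) (k : (mul x y).Idx) :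
    ∃ i j, (mul x y).el k = mul (x.el i) (y.el j) := by
  cases x with
  | ur p => cases y with
    | ur q => exact ⟨PUnit.unit, PUnit.unit, rfl⟩
    | set κ g => exact ⟨PUnit.unit, k, rfl⟩
  | set ι f => cases y with
    | ur q => exact ⟨k, PUnit.unit, rfl⟩
    | set κ g => exact ⟨k.1, k.2, rfl⟩

theorem depth_mul_le {x y : V Q} {γ : Ordinal.{u}} :
    depth x ≤ γ → depth y ≤ γ → depth (mul x y) ≤ γ := by
  refine induction₂ (motive := fun x y : V Q => ∀ γ, depth x ≤ γ → depth y ≤ γ →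
    depth (mul x y) ≤ γ) ?_ ?_ x y γ
  · intro p q γ _ _
    simp [mul_ur_ur, depth]
  · intro x y ih γ hx hy
    rcases eq_or_ne γ 0 with rfl | hγ
    · obtain ⟨p, rfl⟩ := depth_eq_zero_iff.1 (le_antisymm hx zero_le)
      obtain ⟨q, rfl⟩ := depth_eq_zero_iff.1 (le_antisymm hy zero_le)
      simp [mul_ur_ur, depth]
    · have hγ : 0 < γ := pos_iff_ne_zero.2 hγ
      obtain ⟨δ, hδ, h⟩ := (depth_le_iff hγ).1 hx
      obtain ⟨ε, hε, h'⟩ := (depth_le_iff hγ).1 hy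
      refine (depth_le_iff hγ).2 ⟨max δ ε, max_lt hδ hε, fun k => ?_⟩
      obtain ⟨i, j, hk⟩ := exists_of_el_mul x y k
      rw [hk]
      exact ih i j _ ((h i).trans (le_max_left _ _)) ((h' j).trans (le_max_right _ _))

variable [Preorder Q]

theorem mul_le_iff {x y z : V Q} :
    Le (mul x y) z ↔ ∀ i j, ∃ k, Le (mul (x.el i) (y.el j)) (z.el k) := by
  rw [le_iff]
  constructor
  · intro h i j
    obtain ⟨k, hk⟩ := exists_el_mul x y i j
    exact hk ▸ h k
  · intro h k
    obtain ⟨i, j, hk⟩ := exists_of_el_mul x y k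
    exact hk ▸ h i j

theorem le_mul_iff {x y z : V Q} :
    Le z (mul x y) ↔ ∀ k, ∃ i j, Le (z.el k) (mul (x.el i) (y.el j)) := by
  rw [le_iff]
  refine forall_congr' fun k => ⟨fun ⟨l, hl⟩ => ?_, fun ⟨i, j, h⟩ => ?_⟩
  · obtain ⟨i, j, hk⟩ := exists_of_el_mul x y l
    exact ⟨i, j, hk ▸ hl⟩
  · obtain ⟨l, hl⟩ := exists_el_mul x y i j
    exact ⟨l, hl ▸ h⟩

theorem mul_assoc_sim (x y z : V Q) : Sim (mul (mul x y) z) (mul x (mul y z)) := by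
  refine induction₃ (motive := fun x y z : V Q => Sim (mul (mul x y) z) (mul x (mul y z))) ?_ ?_ x y z
  · intro p q r
    simp only [mul_ur_ur, mul_assoc]
    exact Sim.refl _
  · intro x y z ih
    constructor
    · refine mul_le_iff.2 fun l k => ?_
      obtain ⟨i, j, hl⟩ := exists_of_el_mul x y l
      obtain ⟨m, hm⟩ := exists_el_mul y z j k
      obtain ⟨n, hn⟩ := exists_el_mul x (mul y z) i m
      exact ⟨n, by rw [hl, hn, hm]; exact (ih i j k).1⟩
    · refine mul_le_iff.2 fun i l => ?_
      obtain ⟨j, k, hl⟩ := exists_of_el_mul y z l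
      obtain ⟨m, hm⟩ := exists_el_mul x y i j
      obtain ⟨n, hn⟩ := exists_el_mul (mul x y) z m k
      exact ⟨n, by rw [hl, hn, hm]; exact (ih i j k).2⟩

theorem one_mul_sim (x : V Q) : Sim (mul (ur 1) x) x := by
  refine el_induction (motive := fun x : V Q => Sim (mul (ur 1) x) x) ?_ ?_ x
  · intro p
    rw [mul_ur_ur, one_mul]
    exact Sim.refl _
  · intro x ih
    exact ⟨mul_le_iff.2 fun _ j => ⟨j, (ih j).1⟩, le_mul_iff.2 fun k => ⟨PUnit.unit, k, (ih k).2⟩⟩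

theorem mul_one_sim (x : V Q) : Sim (mul x (ur 1)) x := by
  refine el_induction (motive := fun x : V Q => Sim (mul x (ur 1)) x) ?_ ?_ x
  · intro p
    rw [mul_ur_ur, mul_one]
    exact Sim.refl _
  · intro x ih
    exact ⟨mul_le_iff.2 fun j _ => ⟨j, (ih j).1⟩, le_mul_iff.2 fun k => ⟨k, PUnit.unit, (ih k).2⟩⟩

end mul

/-! ### Hereditarily directed sets -/

section her

variable {Q : Type u} [Preorder Q]

/-- All sets that are hereditarily in `x` (including `x`) are non-empty and directed. -/
def Her : V Q → Prop
  | ur _ => True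
  | set ι f => Nonempty ι ∧ (∀ i, Her (f i)) ∧ ∀ i j, ∃ k, Le (f i) (f k) ∧ Le (f j) (f k)

theorem her_iff {x : V Q} : Her x ↔ Nonempty x.Idx ∧ (∀ i, Her (x.el i)) ∧
    ∀ i j, ∃ k, Le (x.el i) (x.el k) ∧ Le (x.el j) (x.el k) := by
  cases x with
  | ur q => exact ⟨fun _ => ⟨⟨PUnit.unit⟩, fun _ => trivial, fun i _ => ⟨i, le_refl _, le_refl _⟩⟩,
      fun _ => trivial⟩
  | set ι f => exact Iff.rfl

theorem Her.hasUr {x : V Q} (h : Her x) : HasUr x := by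
  induction x with
  | ur q => trivial
  | set ι f ih => exact ⟨h.1.some, ih _ (h.2.1 _)⟩

theorem HasUr.idx_nonempty {Q : Type u} {x : V Q} (h : HasUr x) : Nonempty x.Idx := by
  cases x with
  | ur q => exact ⟨PUnit.unit⟩
  | set ι f => exact ⟨h.choose⟩

theorem ExtEq.her {x y : V Q} (h : ExtEq x y) (hx : Her x) : Her y := by
  induction x generalizing y with
  | ur q => cases y with
    | ur r => trivial
    | set κ g => exact h.elim
  | set ι f ih =>
    cases y with
    | ur q => trivial
    | set κ g =>
      refine ⟨?_, fun j => ?_, fun j k => ?_⟩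
      · obtain ⟨j, -⟩ := h.1 hx.1.some
        exact ⟨j⟩
      · obtain ⟨i, hi⟩ := h.2 j
        exact ih i hi (hx.2.1 i)
      · obtain ⟨i, hi⟩ := h.2 j
        obtain ⟨i', hi'⟩ := h.2 k
        obtain ⟨l, h₁, h₂⟩ := hx.2.2 i i'
        obtain ⟨m, hm⟩ := h.1 l
        exact ⟨m, le_trans hi.symm.le (le_trans h₁ hm.le), le_trans hi'.symm.le (le_trans h₂ hm.le)⟩

theorem isUr_mem_iterIdeal {x : V Q} (h : IsUr x) (α : Ordinal.{u}) : x ∈ iterIdeal Q α := by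
  rw [iterIdeal]
  exact .inl h

/-- The recursion on levels splits into a hereditary condition and a depth bound. Having an
urelement in the transitive closure supplies non-emptiness, and conversely hereditarily non-empty
sets bottom out in urelements. -/
theorem mem_iterIdeal {x : V Q} {α : Ordinal.{u}} : x ∈ iterIdeal Q α ↔ Her x ∧ depth x ≤ α := by
  induction x generalizing α with
  | ur q => simp [isUr_mem_iterIdeal (isUr_ur q), Her, depth]
  | set ι f ih =>
    rw [iterIdeal]
    constructor
    · rintro (h | ⟨κ, g, h, hV, hg, hd⟩)
      · exact absurd h (not_isUr_set f)
      · cases h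
        refine ⟨⟨(HasUr.idx_nonempty (hV.resolve_left (not_isUr_set f)).1), fun i => ?_, hd⟩,
          depth_le_iff_rank.2 (hV.imp id And.right)⟩
        obtain ⟨β, hβ, hi⟩ := hg i
        exact ((ih i).1 hi).1
    · rintro ⟨h, hd⟩
      refine .inr ⟨ι, f, rfl, .inr ⟨h.hasUr, ?_⟩, fun i => ?_, h.2.2⟩
      · exact (depth_le_iff_rank.1 hd).resolve_left (not_isUr_set f)
      · exact ⟨depth (f i), (depth_lt_depth_set f i).trans_le hd, (ih i).2 ⟨h.2.1 i, le_rfl⟩⟩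

theorem iterIdeal_mono {α β : Ordinal.{u}} (h : α ≤ β) : iterIdeal Q α ⊆ iterIdeal Q β :=
  fun _ hx => mem_iterIdeal.2 ⟨(mem_iterIdeal.1 hx).1, (mem_iterIdeal.1 hx).2.trans h⟩

theorem ExtEq.mem_iterIdeal {x y : V Q} {α : Ordinal.{u}} (h : ExtEq x y) (hx : x ∈ iterIdeal Q α) :
    y ∈ iterIdeal Q α :=
  V.mem_iterIdeal.2 ⟨h.her (V.mem_iterIdeal.1 hx).1, h.symm.depth_le.trans (V.mem_iterIdeal.1 hx).2⟩

end her

/-! ### Replacing the urelements -/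

section map

variable {Q R : Type u} {φ : Q → R}

theorem exists_el_map (x : V Q) (i : x.Idx) : ∃ k, (map φ x).el k = map φ (x.el i) := by
  cases x with
  | ur p => exact ⟨PUnit.unit, rfl⟩
  | set ι f => exact ⟨i, rfl⟩

theorem exists_of_el_map (x : V Q) (k : (map φ x).Idx) :
    ∃ i, (map φ x).el k = map φ (x.el i) := by
  cases x with
  | ur p => exact ⟨PUnit.unit, rfl⟩
  | set ι f => exact ⟨k, rfl⟩

theorem depth_map (x : V Q) : depth (map φ x) = depth x := by
  induction x with
  | ur q => rfl
  | set ι f ih => simp only [map, depth, ih]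

variable [Preorder R]

theorem map_le_iff {x : V Q} {y : V R} : Le (map φ x) y ↔ ∀ i, ∃ j, Le (map φ (x.el i)) (y.el j) := by
  rw [le_iff]
  constructor
  · intro h i
    obtain ⟨k, hk⟩ := exists_el_map (φ := φ) x i
    exact hk ▸ h k
  · intro h k
    obtain ⟨i, hk⟩ := exists_of_el_map (φ := φ) x k
    exact hk ▸ h i

theorem le_map_iff {x : V Q} {y : V R} : Le y (map φ x) ↔ ∀ j, ∃ i, Le (y.el j) (map φ (x.el i)) := by
  rw [le_iff]
  refine forall_congr' fun j => ⟨fun ⟨k, hk⟩ => ?_, fun ⟨i, hi⟩ => ?_⟩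
  · obtain ⟨i, h⟩ := exists_of_el_map (φ := φ) x k
    exact ⟨i, h ▸ hk⟩
  · obtain ⟨k, hk⟩ := exists_el_map (φ := φ) x i
    exact ⟨k, hk ▸ hi⟩

variable [Preorder Q]

theorem map_le_map_iff (hφ : ∀ p q, φ p ≤ φ q ↔ p ≤ q) {x y : V Q} :
    Le (map φ x) (map φ y) ↔ Le x y := by
  refine induction₂ (motive := fun x y : V Q => Le (map φ x) (map φ y) ↔ Le x y) ?_ ?_ x y
  · intro p q
    simp [map, hφ]
  · intro x y ih
    rw [map_le_iff, le_iff]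
    refine forall_congr' fun i => ⟨fun ⟨k, hk⟩ => ?_, fun ⟨j, hj⟩ => ?_⟩
    · obtain ⟨j, h⟩ := exists_of_el_map (φ := φ) y k
      exact ⟨j, (ih i j).1 (h ▸ hk)⟩
    · obtain ⟨k, hk⟩ := exists_el_map (φ := φ) y j
      exact ⟨k, hk ▸ (ih i j).2 hj⟩

theorem Her.map (hφ : ∀ p q, φ p ≤ φ q ↔ p ≤ q) {x : V Q} (h : Her x) : Her (x.map φ) := by
  induction x with
  | ur q => trivial
  | set ι f ih =>
    refine ⟨h.1, fun i => ih i (h.2.1 i), fun i j => ?_⟩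
    obtain ⟨k, h₁, h₂⟩ := h.2.2 i j
    exact ⟨k, (map_le_map_iff hφ).2 h₁, (map_le_map_iff hφ).2 h₂⟩

end map

end V
end IterIdeal

namespace IterIdeal
namespace V

/-! ### Products of sets over `P^{<ω}` -/

section finSeq

variable {P : Type u} [Preorder P]

theorem mul_mono {x y z w : V (FinSeq P)} :
    Le x z → Le y w → Le (mul x y) (mul z w) := by
  refine induction₄ (motive := fun x y z w : V (FinSeq P) => Le x z → Le y w →
    Le (mul x y) (mul z w)) ?_ ?_ x y z w
  · intro p q r s h h'
    simp only [mul_ur_ur, le_ur_ur] at *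
    exact FinSeq.mul_le_mul h h'
  · intro x y z w ih h h'
    refine mul_le_iff.2 fun i j => ?_
    obtain ⟨k, hk⟩ := le_iff.1 h i
    obtain ⟨l, hl⟩ := le_iff.1 h' j
    obtain ⟨m, hm⟩ := exists_el_mul z w k l
    exact ⟨m, hm ▸ ih i j k l hk hl⟩

theorem Sim.mul {x y z w : V (FinSeq P)} (h : Sim x z) (h' : Sim y w) :
    Sim (mul x y) (mul z w) :=
  ⟨mul_mono h.1 h'.1, mul_mono h.2 h'.2⟩

/-- Elements of `c` and `d` that witness failure of both alternatives have a product below some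
product of elements of `a` and `b`, against the inductive hypothesis. No directedness is needed. -/
theorem le_or_le_of_mul_le_mul {a b c d : V (FinSeq P)} :
    Le (mul c d) (mul a b) → Le c a ∨ Le d b := by
  refine induction₄ (motive := fun a b c d : V (FinSeq P) => Le (mul c d) (mul a b) →
    Le c a ∨ Le d b) ?_ ?_ a b c d
  · intro a b c d h
    simp only [mul_ur_ur, le_ur_ur] at *
    exact FinSeq.le_or_le_of_mul_le_mul h
  · intro a b c d ih h
    by_contra! hn
    obtain ⟨hc, hd⟩ := hn
    simp only [le_iff (x := c), le_iff (x := d), not_forall, not_exists] at hc hd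
    obtain ⟨i, hi⟩ := hc
    obtain ⟨j, hj⟩ := hd
    obtain ⟨m, hm⟩ := mul_le_iff.1 h i j
    obtain ⟨k, l, hkl⟩ := exists_of_el_mul a b m
    rw [hkl] at hm
    exact (ih k l i j hm).elim (hi k) (hj l)

theorem one_le {x : V (FinSeq P)} (hx : Her x) : Le (ur 1) x := by
  refine el_induction (motive := fun x : V (FinSeq P) => Her x → Le (ur 1) x) ?_ ?_ x hx
  · intro p _
    exact le_ur_ur.2 (FinSeq.one_le p)
  · intro x ih hx
    obtain ⟨⟨i⟩, h, -⟩ := her_iff.1 hx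
    exact le_iff.2 fun _ => ⟨i, ih i (h i)⟩

theorem le_mul_left {x y : V (FinSeq P)} (hy : Her y) : Le x (mul x y) :=
  le_trans (mul_one_sim x).2 (mul_mono (le_refl x) (one_le hy))

theorem le_mul_right {x y : V (FinSeq P)} (hx : Her x) : Le y (mul x y) :=
  le_trans (one_mul_sim y).2 (mul_mono (one_le hx) (le_refl y))

theorem Her.mul {x y : V (FinSeq P)} : Her x → Her y → Her (mul x y) := by
  refine induction₂ (motive := fun x y : V (FinSeq P) => Her x → Her y → Her (V.mul x y)) ?_ ?_ x y
  · intro p q _ _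
    trivial
  · intro x y ih hx hy
    obtain ⟨⟨i⟩, hx', hxd⟩ := her_iff.1 hx
    obtain ⟨⟨j⟩, hy', hyd⟩ := her_iff.1 hy
    refine her_iff.2 ⟨⟨(exists_el_mul x y i j).choose⟩, fun k => ?_, fun k l => ?_⟩
    · obtain ⟨i, j, h⟩ := exists_of_el_mul x y k
      exact h ▸ ih i j (hx' i) (hy' j)
    · obtain ⟨i, j, h⟩ := exists_of_el_mul x y k
      obtain ⟨i', j', h'⟩ := exists_of_el_mul x y l
      obtain ⟨m, h₁, h₂⟩ := hxd i i'
      obtain ⟨n, h₃, h₄⟩ := hyd j j'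
      obtain ⟨o, ho⟩ := exists_el_mul x y m n
      refine ⟨o, ?_, ?_⟩
      · rw [h, ho]; exact mul_mono h₁ h₃
      · rw [h', ho]; exact mul_mono h₂ h₄

theorem mul_mem_iterIdeal {x y : V (FinSeq P)} {α : Ordinal.{u}}
    (hx : x ∈ iterIdeal (FinSeq P) α) (hy : y ∈ iterIdeal (FinSeq P) α) :
    mul x y ∈ iterIdeal (FinSeq P) α := by
  rw [mem_iterIdeal] at *
  exact ⟨hx.1.mul hy.1, depth_mul_le hx.2 hy.2⟩

/-! ### Finite products -/

theorem listProd_append (l m : List (V (FinSeq P))) :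
    Sim (listProd (l ++ m)) (mul (listProd l) (listProd m)) := by
  induction l with
  | nil => exact (one_mul_sim _).symm
  | cons x l ih =>
    exact ((Sim.refl x).mul ih).trans (mul_assoc_sim _ _ _).symm

theorem listProd_singleton (x : V (FinSeq P)) : Sim (listProd [x]) x := mul_one_sim x

theorem listProd_mem_iterIdeal {α : Ordinal.{u}} {l : List (V (FinSeq P))}
    (h : ∀ x ∈ l, x ∈ iterIdeal (FinSeq P) α) : listProd l ∈ iterIdeal (FinSeq P) α := by
  induction l with
  | nil => exact isUr_mem_iterIdeal (isUr_ur _) α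
  | cons x l ih =>
    rw [List.forall_mem_cons] at h
    exact mul_mem_iterIdeal h.1 (ih h.2)

theorem listProd_her {l : List (V (FinSeq P))} (h : ∀ x ∈ l, Her x) : Her (listProd l) := by
  induction l with
  | nil => trivial
  | cons x l ih =>
    rw [List.forall_mem_cons] at h
    exact h.1.mul (ih h.2)

theorem le_listProd {x : V (FinSeq P)} {l : List (V (FinSeq P))} (hl : ∀ y ∈ l, Her y)
    (hx : x ∈ l) : Le x (listProd l) := by
  induction l with
  | nil => simp at hx
  | cons y l ih =>
    rw [List.forall_mem_cons] at hl
    rcases List.mem_cons.1 hx with rfl | hx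
    · exact le_mul_left (listProd_her hl.2)
    · exact le_trans (ih hl.2 hx) (le_mul_right hl.1)

/-! ### Hereditarily directed sets over `P` inside those over `P^{<ω}` -/

/-- Witnesses against the two alternatives have a common upper bound in `x` by directedness. This
single element is below neither factor, against the inductive hypothesis. -/
theorem le_or_le_of_le_mul {x : V P} {a b : V (FinSeq P)} (hx : Her x) :
    Le (map FinSeq.single x) (mul a b) → Le (map FinSeq.single x) a ∨ Le (map FinSeq.single x) b := by
  refine induction₃ (motive := fun (x : V P) (a b : V (FinSeq P)) => Her x →
    Le (map FinSeq.single x) (mul a b) →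
    Le (map FinSeq.single x) a ∨ Le (map FinSeq.single x) b) ?_ ?_ x a b hx
  · intro p s t _ h
    simp only [mul_ur_ur, map, le_ur_ur] at *
    exact FinSeq.single_le_mul h
  · intro x a b ih hx h
    obtain ⟨-, hx', hd⟩ := her_iff.1 hx
    by_contra! hn
    simp only [map_le_iff (x := x), not_forall, not_exists] at hn
    obtain ⟨⟨i, hi⟩, ⟨j, hj⟩⟩ := hn
    obtain ⟨k, hik, hjk⟩ := hd i j
    obtain ⟨m, hm⟩ := map_le_iff.1 h k
    obtain ⟨s, t, hst⟩ := exists_of_el_mul a b m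
    rw [hst] at hm
    rw [← map_le_map_iff fun _ _ => FinSeq.single_le_single] at hik hjk
    exact (ih k s t (hx' k) hm).elim (fun h => hi s (le_trans hik h)) (fun h => hj t (le_trans hjk h))

theorem exists_ur_le {Q : Type u} [Preorder Q] {x : V Q} (hx : Her x) : ∃ q, Le (ur q) x := by
  induction x with
  | ur q => exact ⟨q, le_refl _⟩
  | set ι f ih =>
    obtain ⟨q, hq⟩ := ih hx.1.some (hx.2.1 _)
    exact ⟨q, le_trans hq (el_le (set ι f) hx.1.some)⟩

theorem ur_le_map {Q R : Type u} {φ : Q → R} [Preorder R] {x : V Q} {r : R}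
    (h : Le (ur r) (map φ x)) : ∃ q, r ≤ φ q := by
  induction x with
  | ur q => exact ⟨q, le_ur_ur.1 h⟩
  | set ι f ih =>
    obtain ⟨i, hi⟩ := le_map_iff.1 h PUnit.unit
    exact ih i hi

theorem not_map_single_le_one {x : V P} (hx : Her x) : ¬ Le (map FinSeq.single x) (ur 1) := by
  intro h
  obtain ⟨p, hp⟩ := exists_ur_le hx
  have hp' : Le (ur (FinSeq.single p)) (map FinSeq.single x) :=
    (map_le_map_iff (x := ur p) fun _ _ => FinSeq.single_le_single).2 hp
  exact FinSeq.not_single_le_one p (le_ur_ur.1 (le_trans hp' h))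

/-- Elements of `İ*(P)` do not bound the square of any element other than the identity. -/
theorem not_mul_le_map_single {x y z : V P} (hx : Her x) (hy : Her y) :
    ¬ Le (mul (map FinSeq.single x) (map FinSeq.single y)) (map FinSeq.single z) := by
  intro h
  obtain ⟨p, hp⟩ := exists_ur_le hx
  obtain ⟨q, hq⟩ := exists_ur_le hy
  have hp' : Le (ur (FinSeq.single p)) (map FinSeq.single x) :=
    (map_le_map_iff (x := ur p) fun _ _ => FinSeq.single_le_single).2 hp
  have hq' : Le (ur (FinSeq.single q)) (map FinSeq.single y) :=
    (map_le_map_iff (x := ur q) fun _ _ => FinSeq.single_le_single).2 hq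
  -- A word of length two would lie below one of length one.
  obtain ⟨r, hr⟩ := ur_le_map (le_trans (mul_mono hp' hq') h)
  exact FinSeq.not_single_mul_single_le p q r hr

end finSeq

end V

open V

variable {P : Type u} [Preorder P]

/-! ### Elements of `İ*_α(P)` are non-idempotent primes -/

theorem isIdem_congr {x y : V (FinSeq P)} (h : Sim x y) (hx : IsIdem x) : IsIdem y :=
  ((h.mul h).symm.trans hx).trans h

theorem idealsOf_subset {α : Ordinal.{u}} : idealsOf P α ⊆ iterIdeal (FinSeq P) α := by
  rintro _ ⟨x, hx, rfl⟩
  rw [mem_iterIdeal] at *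
  exact ⟨hx.1.map fun _ _ => FinSeq.single_le_single, (depth_map x).trans_le hx.2⟩

theorem idealsOf_mono {α β : Ordinal.{u}} (h : α ≤ β) : idealsOf P α ⊆ idealsOf P β :=
  Set.image_mono (iterIdeal_mono h)

theorem isPrimeIn_of_mem_idealsOf {x : V (FinSeq P)} {α : Ordinal.{u}} (hx : x ∈ idealsOf P α) :
    IsPrimeIn α x := by
  refine ⟨idealsOf_subset hx, ?_⟩
  obtain ⟨x, hx, rfl⟩ := hx
  have hx' := (mem_iterIdeal.1 hx).1
  refine ⟨fun h => not_map_single_le_one hx' h.1, fun a ha b hb h => ?_⟩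
  have ha := (mem_iterIdeal.1 ha).1
  have hb := (mem_iterIdeal.1 hb).1
  exact (le_or_le_of_le_mul hx' h.1).imp (fun h' => ⟨h', le_trans (le_mul_left hb) h.2⟩)
    (fun h' => ⟨h', le_trans (le_mul_right ha) h.2⟩)

theorem not_isIdem_of_mem_idealsOf {x : V (FinSeq P)} {α : Ordinal.{u}} (hx : x ∈ idealsOf P α) :
    ¬ IsIdem x := by
  obtain ⟨x, hx, rfl⟩ := hx
  have hx' := (mem_iterIdeal.1 hx).1
  exact fun h => not_mul_le_map_single hx' hx' h.1

/-! ### The hierarchy of stars -/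

theorem starHier_zero : starHier P 0 = ∅ := by
  rw [starHier, Ordinal.limitRecOn_zero]

theorem starHier_succ (β : Ordinal.{u}) : starHier P (β + 1) = starHier P β ∪
    {x | ∃ X ∈ dotD (starHier P β ∪ idealsOf P β), ∀ y, Mem y x ↔ y ∈ star β X} := by
  rw [starHier, Ordinal.limitRecOn_add_one]
  rfl

theorem starHier_limit {lam : Ordinal.{u}} (h : Order.IsSuccLimit lam) :
    starHier P lam = {x | ∃ β < lam, x ∈ starHier P β} := by
  rw [starHier, Ordinal.limitRecOn_limit _ _ _ _ h]
  ext x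
  simp only [Set.mem_ofPred_eq, exists_prop]
  rfl

/-- The elements of `S_β(P)` together with those of `İ*_β(P)`. -/
def atoms (P : Type u) [Preorder P] (β : Ordinal.{u}) : Set (V (FinSeq P)) :=
  starHier P β ∪ idealsOf P β

/-- `x` is the set `X^*` for a non-empty downward-closed class `X` of atoms of level `β`. -/
def IsStar (β : Ordinal.{u}) (X : Set (V (FinSeq P))) (x : V (FinSeq P)) : Prop :=
  X ∈ dotD (atoms P β) ∧ ∀ y, Mem y x ↔ y ∈ star β X

theorem mem_starHier {x : V (FinSeq P)} {α : Ordinal.{u}} :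
    x ∈ starHier P α ↔ ∃ β < α, ∃ X, IsStar β X x := by
  induction α using Ordinal.limitRecOn with
  | zero => simp [starHier_zero]
  | add_one α ih =>
    rw [starHier_succ, Set.mem_union, ih]
    constructor
    · rintro (⟨β, hβ, h⟩ | ⟨X, hX, h⟩)
      · exact ⟨β, hβ.trans (Order.lt_succ α), h⟩
      · exact ⟨α, Order.lt_succ α, X, hX, h⟩
    · rintro ⟨β, hβ, X, h⟩
      rcases (Order.lt_succ_iff.1 hβ).lt_or_eq with hβ | rfl
      · exact .inl ⟨β, hβ, X, h⟩
      · exact .inr ⟨X, h.1, h.2⟩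
  | limit α hα ih =>
    rw [starHier_limit hα]
    constructor
    · rintro ⟨β, hβ, hx⟩
      obtain ⟨γ, hγ, h⟩ := (ih β hβ).1 hx
      exact ⟨γ, hγ.trans hβ, h⟩
    · rintro ⟨β, hβ, h⟩
      exact ⟨_, hα.succ_lt hβ, (ih _ (hα.succ_lt hβ)).2 ⟨β, Order.lt_succ β, h⟩⟩

theorem starHier_mono {α β : Ordinal.{u}} (h : α ≤ β) : starHier P α ⊆ starHier P β := by
  intro x hx
  obtain ⟨γ, hγ, hx⟩ := mem_starHier.1 hx
  exact mem_starHier.2 ⟨γ, hγ.trans_le h, hx⟩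

theorem atoms_mono {α β : Ordinal.{u}} (h : α ≤ β) : atoms P α ⊆ atoms P β :=
  Set.union_subset_union (starHier_mono h) (idealsOf_mono h)

theorem mem_star_of_mem {β : Ordinal.{u}} {X : Set (V (FinSeq P))} {x : V (FinSeq P)}
    (hx : x ∈ X) (h : x ∈ iterIdeal (FinSeq P) β) : x ∈ star β X :=
  ⟨h, [x], by simpa using hx, (listProd_singleton x).symm⟩

theorem one_mem_star (β : Ordinal.{u}) (X : Set (V (FinSeq P))) : ur 1 ∈ star β X :=
  ⟨isUr_mem_iterIdeal (isUr_ur _) β, [], by simp, Sim.refl _⟩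

theorem mul_mem_star {β : Ordinal.{u}} {X : Set (V (FinSeq P))} {x y : V (FinSeq P)}
    (hx : x ∈ star β X) (hy : y ∈ star β X) : mul x y ∈ star β X := by
  obtain ⟨hx, l, hl, hxl⟩ := hx
  obtain ⟨hy, m, hm, hym⟩ := hy
  refine ⟨mul_mem_iterIdeal hx hy, l ++ m, ?_, (hxl.mul hym).trans (listProd_append l m).symm⟩
  intro b hb
  exact (List.mem_append.1 hb).elim (hl b) (hm b)

namespace IsStar

variable {β : Ordinal.{u}} {X : Set (V (FinSeq P))} {x : V (FinSeq P)}

theorem exists_eq_set (h : IsStar β X x) : ∃ (ι : Type u) (f : ι → V (FinSeq P)), x = set ι f := by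
  cases x with
  | ur q => exact ((h.2 _).2 (one_mem_star β X)).elim
  | set ι f => exact ⟨ι, f, rfl⟩

theorem el_mem (h : IsStar β X x) (i : x.Idx) : x.el i ∈ star β X := by
  obtain ⟨ι, f, rfl⟩ := h.exists_eq_set
  exact (h.2 _).1 ⟨i, ExtEq.refl _⟩

theorem exists_el (h : IsStar β X x) {y : V (FinSeq P)} (hy : y ∈ star β X) :
    ∃ i, ExtEq y (x.el i) := by
  obtain ⟨ι, f, rfl⟩ := h.exists_eq_set
  exact (h.2 _).2 hy

/-- Directedness comes from closure under products: since `1` is least, both factors lie below their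
product. -/
theorem mem_iterIdeal (h : IsStar β X x) : x ∈ iterIdeal (FinSeq P) (Order.succ β) := by
  have hel := fun i => V.mem_iterIdeal.1 (h.el_mem i).1
  refine V.mem_iterIdeal.2 ⟨her_iff.2 ⟨?_, fun i => (hel i).1, fun i j => ?_⟩,
    depth_le_succ_iff.2 fun i => (hel i).2⟩
  · exact ⟨(h.exists_el (one_mem_star β X)).choose⟩
  · obtain ⟨k, hk⟩ := h.exists_el (mul_mem_star (h.el_mem i) (h.el_mem j))
    exact ⟨k, le_trans (le_mul_left (hel j).1) hk.le, le_trans (le_mul_right (hel i).1) hk.le⟩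

theorem isIdem (h : IsStar β X x) : IsIdem x := by
  refine ⟨mul_le_iff.2 fun i j => ?_, le_mul_left (V.mem_iterIdeal.1 h.mem_iterIdeal).1⟩
  obtain ⟨k, hk⟩ := h.exists_el (mul_mem_star (h.el_mem i) (h.el_mem j))
  exact ⟨k, hk.le⟩

/-- If elements `i` and `j` witness failure of the two alternatives, their product is again an
element of `x`, and cancellation contradicts the choice of one of them. -/
theorem le_or_le (h : IsStar β X x) {a b : V (FinSeq P)} (hab : Le x (mul a b)) :
    Le x a ∨ Le x b := by
  by_contra! hn
  simp only [le_iff (x := x), not_forall, not_exists] at hn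
  obtain ⟨⟨i, hi⟩, ⟨j, hj⟩⟩ := hn
  obtain ⟨k, hk⟩ := h.exists_el (mul_mem_star (h.el_mem i) (h.el_mem j))
  obtain ⟨s, t, hst⟩ := le_mul_iff.1 hab k
  exact (le_or_le_of_mul_le_mul (le_trans hk.le hst)).elim (hi s) (hj t)

end IsStar

theorem atoms_subset {α : Ordinal.{u}} : atoms P α ⊆ iterIdeal (FinSeq P) α := by
  rintro x (hx | hx)
  · obtain ⟨β, hβ, X, h⟩ := mem_starHier.1 hx
    exact iterIdeal_mono (Order.succ_le_of_lt hβ) h.mem_iterIdeal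
  · exact idealsOf_subset hx

theorem her_of_mem_atoms {α : Ordinal.{u}} {x : V (FinSeq P)} (hx : x ∈ atoms P α) : Her x :=
  (mem_iterIdeal.1 (atoms_subset hx)).1

/-- A member of `X` lies below `X^*`. -/
theorem IsStar.le_of_mem {β : Ordinal.{u}} {X : Set (V (FinSeq P))} {x y : V (FinSeq P)}
    (h : IsStar β X x) (hy : y ∈ X) : Le y x := by
  obtain ⟨i, hi⟩ := h.exists_el (mem_star_of_mem hy (atoms_subset (h.1.2.1 hy)))
  exact le_trans hi.le (el_le x i)

/-- A star lies above a member of its non-empty `X`, which is an atom of a lower level, so induction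
applies. -/
theorem not_le_one_of_mem_atoms {α : Ordinal.{u}} {x : V (FinSeq P)} (hx : x ∈ atoms P α) :
    ¬ Le x (ur 1) := by
  induction α using WellFoundedLT.induction generalizing x with
  | ind α ih =>
  rcases hx with hx | ⟨x, hx, rfl⟩
  · obtain ⟨β, hβ, X, h⟩ := mem_starHier.1 hx
    obtain ⟨y, hy⟩ := h.1.1
    exact fun hle => ih β hβ (h.1.2.1 hy) (le_trans (h.le_of_mem hy) hle)
  · exact not_map_single_le_one (mem_iterIdeal.1 hx).1

theorem isIdem_of_mem_starHier {x : V (FinSeq P)} {α : Ordinal.{u}} (hx : x ∈ starHier P α) :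
    IsIdem x := by
  obtain ⟨β, -, X, h⟩ := mem_starHier.1 hx
  exact h.isIdem

theorem isPrimeIn_of_mem_starHier {x : V (FinSeq P)} {α : Ordinal.{u}} (hx : x ∈ starHier P α) :
    IsPrimeIn α x := by
  refine ⟨atoms_subset (.inl hx), fun h => not_le_one_of_mem_atoms (.inl hx) h.1,
    fun a ha b hb h => ?_⟩
  have ha := (mem_iterIdeal.1 ha).1
  have hb := (mem_iterIdeal.1 hb).1
  obtain ⟨β, -, X, hX⟩ := mem_starHier.1 hx
  exact (hX.le_or_le h.1).imp (fun h' => ⟨h', le_trans (le_mul_left hb) h.2⟩)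
    (fun h' => ⟨h', le_trans (le_mul_right ha) h.2⟩)

end IterIdeal

namespace IterIdeal

/-! ### A partition theorem for well-founded trees of finite increasing sequences -/

/-- Fusion: keep the minimum `n` of the current set and shrink the remainder to a set that is good
for `n`. The kept minima form `H`, and those after `n` all lie in the set chosen for `n`. -/
theorem exists_infinite_diagonal {X : Set ℕ} (hX : X.Infinite) {Φ : ℕ → Set ℕ → Prop}
    (hΦ : ∀ n ∈ X, ∀ Y ⊆ X, Y.Infinite → (∀ m ∈ Y, n < m) → ∃ Z ⊆ Y, Z.Infinite ∧ Φ n Z)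
    (anti : ∀ n Y Z, Φ n Y → Z ⊆ Y → Φ n Z) :
    ∃ H ⊆ X, H.Infinite ∧ ∀ n ∈ H, Φ n {m ∈ H | n < m} := by
  have key : ∀ Y : {Y : Set ℕ // Y ⊆ X ∧ Y.Infinite}, ∃ Z : {Y : Set ℕ // Y ⊆ X ∧ Y.Infinite},
      Z.1 ⊆ Y.1 ∧ (∀ m ∈ Z.1, sInf Y.1 < m) ∧ Φ (sInf Y.1) Z.1 := by
    rintro ⟨Y, hYX, hY⟩
    obtain ⟨Z, hZ, hZi, hZΦ⟩ := hΦ (sInf Y) (hYX (Nat.sInf_mem hY.nonempty)) (Y \ Set.Iic (sInf Y))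
      (Set.sdiff_subset.trans hYX) (hY.sdiff (Set.finite_Iic _)) (fun m hm => not_le.1 hm.2)
    exact ⟨⟨Z, (hZ.trans Set.sdiff_subset).trans hYX, hZi⟩, hZ.trans Set.sdiff_subset,
      fun m hm => not_le.1 (hZ hm).2, hZΦ⟩
  choose next hsub hlt hnext using key
  let Y : ℕ → {Y : Set ℕ // Y ⊆ X ∧ Y.Infinite} := fun k => next^[k] ⟨X, subset_rfl, hX⟩
  have hY : ∀ k, Y (k + 1) = next (Y k) := fun k => Function.iterate_succ_apply' _ _ _
  have hanti : Antitone fun k => (Y k).1 := antitone_nat_of_succ_le fun k => by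
    rw [hY]; exact hsub _
  let a : ℕ → ℕ := fun k => sInf (Y k).1
  have ha : ∀ k, a k ∈ (Y k).1 := fun k => Nat.sInf_mem (Y k).2.2.nonempty
  have hmono : StrictMono a := strictMono_nat_of_lt_succ fun k =>
    hlt (Y k) _ (by rw [← hY]; exact ha (k + 1))
  refine ⟨Set.range a, ?_, Set.infinite_range_of_injective hmono.injective, ?_⟩
  · rintro _ ⟨k, rfl⟩
    exact (Y k).2.1 (ha k)
  · rintro _ ⟨k, rfl⟩
    refine anti _ _ _ (hnext (Y k)) ?_
    rintro _ ⟨⟨j, rfl⟩, hj⟩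
    rw [← hY]
    exact hanti (Nat.succ_le_of_lt (hmono.lt_iff_lt.1 hj)) (ha j)

/-- `l` is a strictly increasing sequence of elements of `H`. -/
def IncIn (H : Set ℕ) (l : List ℕ) : Prop := l.Pairwise (· < ·) ∧ ∀ n ∈ l, n ∈ H

/-- `A` and `B` exclude each other along extensions, and `r` bounds how long both can remain
undecided. Induction on `r` handles each one-letter extension of `l`, and the diagonal lemma makes
the resulting sets uniform. -/
theorem exists_infinite_homogeneous {A B : List ℕ → Prop} {r : List ℕ → Ordinal.{u}}
    (hA : ∀ l m, (l ++ m).Pairwise (· < ·) → A l → ¬ B (l ++ m))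
    (hB : ∀ l m, (l ++ m).Pairwise (· < ·) → B l → ¬ A (l ++ m))
    (hr : ∀ l n, (l ++ [n]).Pairwise (· < ·) → ¬ A l → ¬ B l → r (l ++ [n]) < r l)
    (l : List ℕ) (hl : l.Pairwise (· < ·)) (X : Set ℕ) (hX : X.Infinite)
    (hlX : ∀ a ∈ l, ∀ n ∈ X, a < n) :
    ∃ H ⊆ X, H.Infinite ∧ ((∀ m, IncIn H m → ¬ A (l ++ m)) ∨ (∀ m, IncIn H m → ¬ B (l ++ m))) := by
  induction hγ : r l using WellFoundedLT.induction generalizing l X with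
  | ind γ ih =>
  have happ : ∀ m, IncIn X m → (l ++ m).Pairwise (· < ·) := fun m hm =>
    List.pairwise_append.2 ⟨hl, hm.1, fun a ha b hb => hlX a ha b (hm.2 b hb)⟩
  by_cases hAl : A l
  · exact ⟨X, subset_rfl, hX, .inr fun m hm => hA l m (happ m hm) hAl⟩
  by_cases hBl : B l
  · exact ⟨X, subset_rfl, hX, .inl fun m hm => hB l m (happ m hm) hBl⟩
  obtain ⟨H, hHX, hH, hHΦ⟩ := exists_infinite_diagonal hX
    (Φ := fun n Y => (∀ m, IncIn Y m → ¬ A (l ++ [n] ++ m)) ∨ (∀ m, IncIn Y m → ¬ B (l ++ [n] ++ m)))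
    (fun n hn Y hYX hY hnY => by
      have hs := happ [n] ⟨List.pairwise_singleton _ _, by simpa using hn⟩
      refine ih (r (l ++ [n])) (hγ ▸ hr l n hs hAl hBl) _ hs Y hY ?_ rfl
      intro a ha m hm
      rcases List.mem_append.1 ha with ha | ha
      · exact hlX a ha m (hYX hm)
      · rw [List.mem_singleton.1 ha]
        exact hnY m hm)
    (fun n Y Z hY hZ => hY.imp (fun h m hm => h m ⟨hm.1, fun k hk => hZ (hm.2 k hk)⟩)
      (fun h m hm => h m ⟨hm.1, fun k hk => hZ (hm.2 k hk)⟩))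
  have fin : ∀ (C : List ℕ → Prop) (H' : Set ℕ), H' ⊆ H → ¬ C l →
      (∀ n ∈ H', ∀ m, IncIn {m ∈ H | n < m} m → ¬ C (l ++ [n] ++ m)) →
      ∀ m, IncIn H' m → ¬ C (l ++ m) := by
    intro C H' hH' hC h m hm
    cases m with
    | nil => simpa using hC
    | cons n m =>
      obtain ⟨h₁, h₂⟩ := List.pairwise_cons.1 hm.1
      have := h n (hm.2 n (by simp)) m ⟨h₂, fun k hk => ⟨hH' (hm.2 k (by simp [hk])), h₁ k hk⟩⟩
      simpa using this
  -- Pigeonhole on the first letter: `A` is avoided after infinitely many `n`, or `B` is avoided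
  -- after all but finitely many.
  by_cases hinf : {n ∈ H | ∀ m, IncIn {m ∈ H | n < m} m → ¬ A (l ++ [n] ++ m)}.Infinite
  · exact ⟨_, (Set.sep_subset _ _).trans hHX, hinf, .inl (fin A _ (Set.sep_subset _ _) hAl
      fun n hn => hn.2)⟩
  · refine ⟨_, Set.sdiff_subset.trans hHX, hH.sdiff (Set.not_infinite.1 hinf),
      .inr (fin B _ Set.sdiff_subset hBl fun n hn => ?_)⟩
    exact (hHΦ n hn.1).resolve_left fun h => hn.2 ⟨hn.1, h⟩

/-! ### The tree of a bad sequence -/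

namespace V

section tree

variable {R : Type u} [Preorder R]

open Classical in
/-- An element of `x` that is not below any element of `y`, if there is one. -/
noncomputable def choice (x y : V R) : V R :=
  if h : ∃ i, ∀ j, ¬ Le (x.el i) (y.el j) then x.el h.choose else x

theorem choice_spec {x y : V R} (h : ¬ Le x y) :
    (∃ i, choice x y = x.el i) ∧ ∀ j, ¬ Le (choice x y) (y.el j) := by
  simp only [le_iff (x := x), not_forall, not_exists] at h
  rw [choice, dif_pos h]
  exact ⟨⟨_, rfl⟩, h.choose_spec⟩

/-- The tree of iterated choices of elements that starts with the sequence `x`. -/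
noncomputable def tree (x : ℕ → V R) : List ℕ → V R
  -- A dummy value; the lemmas below concern non-empty sequences.
  | [] => x 0
  | [n] => x n
  | a :: b :: l => choice (tree x (a :: b :: l).dropLast) (tree x (b :: l))
termination_by l => l.length

theorem tree_concat (x : ℕ → V R) {l : List ℕ} (hl : l ≠ []) (n : ℕ) :
    tree x (l ++ [n]) = choice (tree x l) (tree x (l.tail ++ [n])) := by
  obtain ⟨a, l, rfl⟩ := List.exists_cons_of_ne_nil hl
  rw [List.tail_cons, List.cons_append]
  rcases h : l ++ [n] with _ | ⟨b, m⟩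
  · simp at h
  · rw [tree, ← h, ← List.cons_append, List.dropLast_concat]

variable {x : ℕ → V R}

/-- Badness propagates up the tree. The node at `l' ++ [m]` is chosen outside the lower closure of
the elements of the node at `l'.tail ++ [m]`, and the node one step beyond the latter is one of
those elements. -/
theorem tree_not_le (hx : ∀ i j, i < j → ¬ Le (x i) (x j)) (l : List ℕ) (hl : l ≠ []) (n : ℕ)
    (hs : (l ++ [n]).Pairwise (· < ·)) : ¬ Le (tree x l) (tree x (l.tail ++ [n])) := by
  induction hk : l.length generalizing l n with
  | zero => exact absurd (List.length_eq_zero_iff.1 hk) hl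
  | succ k ih =>
    rcases List.eq_nil_or_concat' l with rfl | ⟨l', m, rfl⟩
    · simp at hk
    rcases eq_or_ne l' [] with rfl | hl'
    · simpa [tree] using hx m n (by simpa using hs)
    · obtain ⟨h₁, h₂⟩ := choice_spec (ih l' hl' m (List.pairwise_append.1 hs).1 (by simpa using hk))
      rw [← tree_concat x hl'] at h₁ h₂
      obtain ⟨a, l', rfl⟩ := List.exists_cons_of_ne_nil hl'
      simp only [List.tail_cons, List.cons_append] at h₁ h₂ hs ⊢
      obtain ⟨h₃, -⟩ := choice_spec (ih (l' ++ [m]) (by simp) n (List.pairwise_cons.1 hs).2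
        (by simpa using hk))
      rw [← tree_concat x (by simp)] at h₃
      obtain ⟨j, hj⟩ := h₃
      rw [hj]
      exact h₂ j

theorem tree_concat_mem (hx : ∀ i j, i < j → ¬ Le (x i) (x j)) {l : List ℕ} (hl : l ≠ []) {n : ℕ}
    (hs : (l ++ [n]).Pairwise (· < ·)) : ∃ i, tree x (l ++ [n]) = (tree x l).el i := by
  rw [tree_concat x hl]
  exact (choice_spec (tree_not_le hx l hl n hs)).1

theorem tree_not_le_tail (hx : ∀ i j, i < j → ¬ Le (x i) (x j)) {l : List ℕ} (hl : 2 ≤ l.length)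
    (hs : l.Pairwise (· < ·)) (j) : ¬ Le (tree x l) ((tree x l.tail).el j) := by
  rcases List.eq_nil_or_concat' l with rfl | ⟨l', m, rfl⟩
  · simp at hl
  · have hl' : l' ≠ [] := by rintro rfl; simp at hl
    revert j
    rw [List.tail_append_of_ne_nil hl']
    intro j
    rw [tree_concat x hl']
    exact (choice_spec (tree_not_le hx l' hl' m hs)).2 j

/-- An urelement is its only element, so from there on the choices are stationary. -/
theorem tree_append_eq_ur (hx : ∀ i j, i < j → ¬ Le (x i) (x j)) {l : List ℕ} (hl : l ≠ []) {q : R}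
    (hq : tree x l = ur q) (m : List ℕ) (hs : (l ++ m).Pairwise (· < ·)) :
    tree x (l ++ m) = ur q := by
  induction m using List.reverseRecOn with
  | nil => simpa using hq
  | append_singleton m n ih =>
    rw [← List.append_assoc] at hs ⊢
    obtain ⟨i, hi⟩ := tree_concat_mem hx (by simp [hl]) hs
    rw [hi]
    have := ih (List.pairwise_append.1 hs).1
    revert i
    rw [this]
    exact fun _ _ => rfl

theorem depth_tree_concat_lt (hx : ∀ i j, i < j → ¬ Le (x i) (x j)) {l : List ℕ} (hl : l ≠ [])
    {n : ℕ} (hs : (l ++ [n]).Pairwise (· < ·)) (hu : ¬ IsUr (tree x l)) :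
    depth (tree x (l ++ [n])) < depth (tree x l) := by
  obtain ⟨i, hi⟩ := tree_concat_mem hx hl hs
  rw [hi]
  exact depth_el_lt (pos_iff_ne_zero.2 (mt depth_eq_zero_iff.1 hu)) le_rfl i

theorem depth_tree_append_le (hx : ∀ i j, i < j → ¬ Le (x i) (x j)) {l : List ℕ} (hl : l ≠ [])
    (m : List ℕ) (hs : (l ++ m).Pairwise (· < ·)) : depth (tree x (l ++ m)) ≤ depth (tree x l) := by
  induction m using List.reverseRecOn with
  | nil => simp
  | append_singleton m n ih =>
    rw [← List.append_assoc] at hs ⊢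
    have hm := ih (List.pairwise_append.1 hs).1
    by_cases hu : IsUr (tree x (l ++ m))
    · obtain ⟨q, hq⟩ := hu
      rw [tree_append_eq_ur hx (by simp [hl]) hq [n] hs]
      simp [depth]
    · exact (depth_tree_concat_lt hx (by simp [hl]) hs hu).le.trans hm

theorem depth_tree_append_lt (hx : ∀ i j, i < j → ¬ Le (x i) (x j)) {l : List ℕ} (hl : l ≠ [])
    {m : List ℕ} (hm : m ≠ []) (hs : (l ++ m).Pairwise (· < ·)) (hu : ¬ IsUr (tree x l)) :
    depth (tree x (l ++ m)) < depth (tree x l) := by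
  obtain ⟨n, m, rfl⟩ := List.exists_cons_of_ne_nil hm
  rw [List.append_cons] at hs ⊢
  exact (depth_tree_append_le hx (by simp) m hs).trans_lt
    (depth_tree_concat_lt hx hl (List.pairwise_append.1 hs).1 hu)

theorem exists_append_isUr (hx : ∀ i j, i < j → ¬ Le (x i) (x j)) {H : Set ℕ} (hH : H.Infinite)
    {l : List ℕ} (hl : l ≠ []) (hs : IncIn H l) : ∃ m, IncIn H (l ++ m) ∧ IsUr (tree x (l ++ m)) := by
  induction hγ : depth (tree x l) using WellFoundedLT.induction generalizing l with
  | ind γ ih =>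
  by_cases hu : IsUr (tree x l)
  · exact ⟨[], by simpa using hs, by simpa using hu⟩
  · obtain ⟨n, hn, hln⟩ := hH.exists_gt (l.foldr max 0)
    have hln : ∀ a ∈ l, a < n := fun a ha => lt_of_le_of_lt (List.le_max_of_le' 0 ha le_rfl) hln
    have hs' : IncIn H (l ++ [n]) := by
      refine ⟨List.pairwise_append.2 ⟨hs.1, List.pairwise_singleton _ _, by simpa using hln⟩, ?_⟩
      intro a ha
      rcases List.mem_append.1 ha with ha | ha
      · exact hs.2 a ha
      · rwa [List.mem_singleton.1 ha]
    obtain ⟨m, hm, hu⟩ := ih _ (hγ ▸ depth_tree_concat_lt hx hl hs'.1 hu) (by simp) hs' rfl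
    exact ⟨[n] ++ m, by simpa using hm, by simpa using hu⟩

end tree

end V
end IterIdeal

namespace IterIdeal

theorem InitSeg.trans {s t r : Set ℕ} (h : InitSeg s t) (h' : InitSeg t r) : InitSeg s r :=
  ⟨h.1.trans h'.1, fun a ha b hb hab => h.2 a (h'.2 a ha b (h.1 hb) hab) b hb hab⟩

theorem InitSeg.exists_sort_eq {s t : Finset ℕ} (h : InitSeg s t) :
    ∃ m, t.sort = s.sort ++ m ∧ (s ≠ t → m ≠ []) := by
  have hst : s ⊆ t := Finset.coe_subset.1 h.1
  have hlt : ∀ a ∈ s, ∀ b ∈ t \ s, a < b := by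
    intro a ha b hb
    rw [Finset.mem_sdiff] at hb
    exact not_le.1 fun hba => hb.2 (h.2 b hb.1 a ha hba)
  have hsort : (s.sort ++ (t \ s).sort).Pairwise (· < ·) := by
    refine List.pairwise_append.2 ⟨(Finset.sortedLT_sort s).pairwise,
      (Finset.sortedLT_sort _).pairwise, fun a ha b hb => ?_⟩
    rw [Finset.mem_sort] at ha hb
    exact hlt a ha b hb
  have hnd : (s.sort ++ (t \ s).sort).Nodup := hsort.imp fun h => h.ne
  refine ⟨(t \ s).sort, ?_, fun hne hm => hne ?_⟩
  · have := (List.toFinset_sort (r := (· ≤ ·)) hnd).2 (hsort.imp fun h => h.le)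
    rw [← this]
    congr 1
    rw [List.toFinset_append, Finset.sort_toFinset, Finset.sort_toFinset,
      Finset.union_sdiff_of_subset hst]
  · refine hst.antisymm (Finset.sdiff_eq_empty_iff_subset.1 ?_)
    rw [← Finset.sort_toFinset (t \ s) (· ≤ ·), hm, List.toFinset_nil]

theorem sort_eq_min'_cons {s : Finset ℕ} (h : s.Nonempty) :
    s.sort = s.min' h :: (s.erase (s.min' h)).sort := by
  conv_lhs => rw [← Finset.insert_erase (s.min'_mem h)]
  exact Finset.sort_insert _ (fun b hb => s.min'_le b (Finset.mem_of_mem_erase hb))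
    (Finset.notMem_erase _ _)

theorem sort_ne_nil {s : Finset ℕ} (h : s.Nonempty) : s.sort ≠ [] := by
  rw [sort_eq_min'_cons h]
  simp

theorem pairwise_lt_sort (s : Finset ℕ) : s.sort.Pairwise (· < ·) :=
  (Finset.sortedLT_sort s).pairwise

open V

/-! ### The front of leaves -/

section front

variable {R : Type u} [Preorder R] {x : ℕ → V R}

/-- The non-empty finite subsets of `H` on which the tree of `x` first reaches an urelement. -/
def leafFront (x : ℕ → V R) (H : Set ℕ) : Set (Finset ℕ) :=
  {s | (s : Set ℕ) ⊆ H ∧ s.Nonempty ∧ IsUr (tree x s.sort) ∧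
    ∀ t : Finset ℕ, t.Nonempty → InitSeg t s → IsUr (tree x t.sort) → t = s}

theorem tree_sort_eq_ur (hx : ∀ i j, i < j → ¬ Le (x i) (x j)) {s t : Finset ℕ}
    (hs : s.Nonempty) (h : InitSeg s t) {q : R} (hq : tree x s.sort = ur q) :
    tree x t.sort = ur q := by
  obtain ⟨m, hm, -⟩ := h.exists_sort_eq
  have := pairwise_lt_sort t
  rw [hm] at this ⊢
  exact tree_append_eq_ur hx (sort_ne_nil hs) hq m this

/-- Along `X` the depth drops strictly with each letter until an urelement is reached; the shortest
non-empty initial segment reaching one is in the front. -/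
theorem exists_initSeg_leafFront (hx : ∀ i j, i < j → ¬ Le (x i) (x j)) {H X : Set ℕ}
    (hX : X.Infinite) (hXH : X ⊆ H) : ∃ s ∈ leafFront x H, InitSeg s X := by
  have step : ∀ γ : Ordinal.{u}, ∀ s : Finset ℕ, s.Nonempty → InitSeg s X →
      depth (tree x s.sort) = γ → ∃ s : Finset ℕ, s.Nonempty ∧ InitSeg s X ∧
        IsUr (tree x s.sort) := by
    intro γ
    induction γ using WellFoundedLT.induction with
    | ind γ ih =>
    intro s hs hsX hγ
    by_cases hu : IsUr (tree x s.sort)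
    · exact ⟨s, hs, hsX, hu⟩
    have hinf : (X \ ↑s : Set ℕ).Infinite := hX.sdiff s.finite_toSet
    set n := sInf (X \ ↑s : Set ℕ) with hn
    have hnX : n ∈ X \ ↑s := Nat.sInf_mem hinf.nonempty
    have hins : InitSeg s (insert n s : Finset ℕ) := by
      refine ⟨by simp, fun a ha b hb hab => ?_⟩
      rcases Finset.mem_insert.1 (Finset.mem_coe.1 ha) with rfl | ha
      · exact hsX.2 _ hnX.1 b hb hab
      · exact ha
    have hins' : InitSeg (insert n s : Finset ℕ) X := by
      refine ⟨?_, fun a ha b hb hab => ?_⟩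
      · rw [Finset.coe_insert]
        exact Set.insert_subset hnX.1 hsX.1
      · by_contra has
        have has : a ≠ n ∧ a ∉ s := by simpa using has
        have hna : n ≤ a := Nat.sInf_le ⟨ha, has.2⟩
        rcases Finset.mem_insert.1 (Finset.mem_coe.1 hb) with rfl | hb
        · exact has.1 (le_antisymm hab hna)
        · exact has.2 (hsX.2 a ha b hb hab)
    obtain ⟨m, hm, hm'⟩ := hins.exists_sort_eq
    have hsort := pairwise_lt_sort (insert n s)
    refine ih _ ?_ (insert n s) (by simp) hins' rfl
    rw [← hγ]
    rw [hm] at hsort ⊢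
    exact depth_tree_append_lt hx (sort_ne_nil hs)
      (hm' fun h => hnX.2 (h ▸ Finset.mem_insert_self n s)) hsort hu
  have hne : ∃ k, ∃ s : Finset ℕ, s.card = k ∧ s.Nonempty ∧ InitSeg s X ∧
      IsUr (tree x s.sort) := by
    obtain ⟨s, hs⟩ := step _ {sInf X} (by simp) ⟨by simpa using Nat.sInf_mem hX.nonempty,
      fun a ha b hb hab => by
        rw [Finset.coe_singleton, Set.mem_singleton_iff] at *
        exact le_antisymm (hb ▸ hab) (Nat.sInf_le ha)⟩ rfl
    exact ⟨_, s, rfl, hs⟩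
  classical
  obtain ⟨s, hk, hs, hsX, hu⟩ := Nat.find_spec hne
  refine ⟨s, ⟨hsX.1.trans hXH, hs, hu, fun t ht hts htu => ?_⟩, hsX⟩
  refine Finset.eq_of_subset_of_card_le (Finset.coe_subset.1 hts.1) ?_
  rw [hk]
  exact Nat.find_min' hne ⟨t, rfl, ht, hts.trans hsX, htu⟩

theorem exists_min'_leafFront (hx : ∀ i j, i < j → ¬ Le (x i) (x j)) {H : Set ℕ}
    (hH : H.Infinite) {n : ℕ} (hn : n ∈ H) : ∃ s ∈ leafFront x H, ∃ hs : s.Nonempty, s.min' hs = n := by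
  have hX : {m ∈ H | n ≤ m}.Infinite := by
    refine (hH.sdiff (Set.finite_Iio n)).mono fun m hm => ⟨hm.1, not_lt.1 hm.2⟩
  obtain ⟨s, hs, hsX⟩ := exists_initSeg_leafFront hx hX (Set.sep_subset _ _)
  refine ⟨s, hs, hs.2.1, le_antisymm (Finset.min'_le _ _ ?_) ((hsX.1 (s.min'_mem hs.2.1)).2)⟩
  exact hsX.2 n ⟨hn, le_rfl⟩ _ (s.min'_mem hs.2.1) (hsX.1 (s.min'_mem hs.2.1)).2

theorem base_leafFront (H : Set ℕ) : base (leafFront x H) ⊆ H := by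
  rintro n ⟨s, hs, hn⟩
  exact hs.1 hn

theorem not_isUr_of_mem_frontTree {H : Set ℕ} {s : Finset ℕ}
    (hs : s ∈ frontTree (leafFront x H)) (hne : s.Nonempty) : ¬ IsUr (tree x s.sort) := by
  obtain ⟨-, t, ht, hst, h⟩ := hs
  exact fun hu => h (ht.2.2.2 s hne hst hu)

-- Depth decreases strictly before a leaf and is the successor of the rank. Hence nodes of depth at
-- most `β` that are sets have rank below `β`, and the empty sequence can be given rank exactly `β`.
open Classical in
theorem isFront_leafFront (hx : ∀ i j, i < j → ¬ Le (x i) (x j)) {H : Set ℕ} (hH : H.Infinite)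
    {β : Ordinal.{u}} (hβ : ∀ n, depth (x n) ≤ β) :
    IsFront (leafFront x H) fun s => if s = ∅ then β else rank (tree x s.sort) where
  infinite := by
    intro hfin
    refine hH ((hfin.image fun s => if h : s.Nonempty then s.min' h else 0).subset fun n hn => ?_)
    obtain ⟨s, hs, hne, hmin⟩ := exists_min'_leafFront hx hH hn
    exact ⟨s, hs, by simp [hne, hmin]⟩
  antichain s hs t ht hst := ht.2.2.2 s hs.2.1 hst hs.2.2.1
  bar X hX hXi := by
    obtain ⟨s, hs, hsX⟩ := exists_initSeg_leafFront hx hXi (hX.trans (base_leafFront H))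
    exact ⟨s, hs, hsX⟩
  rk_lt s hs t ht hst hne := by
    have htne : t.Nonempty := by
      rw [Finset.nonempty_iff_ne_empty]
      rintro rfl
      exact hne (Finset.subset_empty.1 (Finset.coe_subset.1 hst.1))
    have htu := not_isUr_of_mem_frontTree ht htne
    rw [if_neg htne.ne_empty]
    split_ifs with hs0
    · rw [← Order.succ_le_iff, ← depth_eq_succ_rank htu]
      have h := pairwise_lt_sort t
      rw [sort_eq_min'_cons htne] at h ⊢
      refine le_trans (depth_tree_append_le hx (l := [t.min' htne]) (by simp) _ h) ?_
      simpa [tree] using hβ _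
    · have hsne := Finset.nonempty_iff_ne_empty.2 hs0
      have hsu := not_isUr_of_mem_frontTree hs hsne
      rw [← Order.succ_lt_succ_iff, ← depth_eq_succ_rank htu, ← depth_eq_succ_rank hsu]
      obtain ⟨m, hm, hm'⟩ := hst.exists_sort_eq
      have h := pairwise_lt_sort t
      rw [hm] at h ⊢
      exact depth_tree_append_lt hx (sort_ne_nil hsne) (hm' hne) h hsu

/-- There is an `r` that extends `s` while `r` without its minimum extends `t`: either `t` with `min
s` added, or `s` itself. Urelements persist under extension, so the tree has the values `p` and `q`
there, and the choice at `r` rules out `p ≤ q`. -/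
theorem not_le_of_tri (hx : ∀ i j, i < j → ¬ Le (x i) (x j)) {s t : Finset ℕ} {p q : R}
    (hp : tree x s.sort = ur p) (hq : tree x t.sort = ur q) (h : Tri s t) : ¬ p ≤ q := by
  obtain ⟨hs, ht, hlt, h⟩ := h
  have hext : ∃ (r : Finset ℕ) (hr : r.Nonempty), tree x r.sort = ur p ∧
      tree x (r.erase (r.min' hr)).sort = ur q ∧ (r.erase (r.min' hr)).Nonempty := by
    rcases h with h | h
    · have hmin : ∀ a ∈ t, s.min' hs < a := fun a ha => hlt.trans_le (t.min'_le a ha)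
      have hins : (insert (s.min' hs) t).min' (by simp) = s.min' hs := by
        refine le_antisymm (Finset.min'_le _ _ (by simp)) (Finset.le_min' _ _ _ fun a ha => ?_)
        rcases Finset.mem_insert.1 ha with rfl | ha
        · exact le_rfl
        · exact (hmin a ha).le
      have her : (insert (s.min' hs) t).erase (s.min' hs) = t :=
        Finset.erase_insert fun hm => (hmin _ hm).false
      refine ⟨insert (s.min' hs) t, by simp, ?_, by rw [hins, her, hq], by rwa [hins, her]⟩
      refine tree_sort_eq_ur hx hs ⟨fun a ha => ?_, fun a ha b hb hab => ?_⟩ hp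
      · rcases eq_or_ne a (s.min' hs) with rfl | hne
        · simp
        · simpa using Or.inr (Finset.mem_coe.1 (h.1 (by simpa [hne] using ha)))
      · rcases Finset.mem_insert.1 (Finset.mem_coe.1 ha) with rfl | ha
        · exact s.min'_mem hs
        · rcases eq_or_ne b (s.min' hs) with rfl | hne
          · exact absurd hab (not_le.2 (hmin a ha))
          · have := h.2 a ha b (by simpa [hne] using hb) hab
            exact Finset.mem_of_mem_erase (Finset.mem_coe.1 this)
    · exact ⟨s, hs, hp, tree_sort_eq_ur hx ht h hq, ht.mono (Finset.coe_subset.1 h.1)⟩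
  obtain ⟨r, hr, hrp, hrq, h2⟩ := hext
  have hlen : 2 ≤ r.sort.length := by
    rw [sort_eq_min'_cons hr, sort_eq_min'_cons h2]
    simp
  have key := tree_not_le_tail hx hlen (pairwise_lt_sort r)
  have htail : r.sort.tail = (r.erase (r.min' hr)).sort := by
    rw [sort_eq_min'_cons hr, List.tail_cons]
  rw [htail, hrp, hrq] at key
  exact fun hle => key PUnit.unit (le_ur_ur.2 hle)

end front

/-- Over a `(β + 1)`-wqo `P` with one additional, isolated, urelement, the sets in `V̇_β` are well
quasi-ordered. -/
theorem exists_le_of_isAlphaWqo {P : Type u} [Preorder P] {β : Ordinal.{u}}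
    (hP : IsAlphaWqo P (β + 1)) (x : ℕ → V (P ⊕ PUnit.{u + 1})) (hβ : ∀ n, depth (x n) ≤ β) :
    ∃ i j, i < j ∧ Le (x i) (x j) := by
  by_contra! hx
  have htype : ∀ (C D : P ⊕ PUnit.{u + 1} → Prop), (∀ q, C q → ¬ D q) → ∀ l m : List ℕ,
      (l ++ m).Pairwise (· < ·) → (l ≠ [] ∧ ∃ q, tree x l = ur q ∧ C q) →
        ¬ (l ++ m ≠ [] ∧ ∃ q, tree x (l ++ m) = ur q ∧ D q) := by
    rintro C D hCD l m hs ⟨hl, q, hq, hC⟩ ⟨-, r, hr, hD⟩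
    rw [tree_append_eq_ur hx hl hq m hs] at hr
    cases hr
    exact hCD q hC hD
  classical
  obtain ⟨H, -, hH, h⟩ := exists_infinite_homogeneous
    (A := fun l => l ≠ [] ∧ ∃ q, tree x l = ur q ∧ q.isRight)
    (B := fun l => l ≠ [] ∧ ∃ q, tree x l = ur q ∧ ¬ q.isRight)
    -- The first letter leads to some `x n` of depth at most `β`, so the empty sequence needs the
    -- rank `succ β`.
    (r := fun l => if l = [] then Order.succ β else depth (tree x l))
    (htype _ _ fun _ h h' => h' h) (htype _ _ fun _ h h' => h h')
    (fun l n hs hA hB => by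
      rcases eq_or_ne l [] with rfl | hl
      · simpa [tree, Order.lt_succ_iff] using hβ n
      · simp only [List.append_eq_nil_iff, List.cons_ne_self, hl, and_self, if_false]
        refine depth_tree_concat_lt hx hl hs ?_
        rintro ⟨q, hq⟩
        by_cases hr : q.isRight
        · exact hA ⟨hl, q, hq, hr⟩
        · exact hB ⟨hl, q, hq, hr⟩)
    [] List.Pairwise.nil Set.univ Set.infinite_univ (by simp)
  rcases h with h | h
  -- No leaf over `H` is the extra urelement, so the leaves form a bad array in `P` on a front of
  -- rank `β < β + 1`.
  · have hleft : ∀ s : leafFront x H, ∃ p : P, tree x s.1.sort = ur (.inl p) := by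
      rintro ⟨s, hs⟩
      obtain ⟨q, hq⟩ := hs.2.2.1
      rcases q with p | q
      · exact ⟨p, hq⟩
      · have := h s.sort ⟨pairwise_lt_sort s, fun n hn => hs.1 ((Finset.mem_sort _).1 hn)⟩
        rw [List.nil_append] at this
        exact absurd ⟨sort_ne_nil hs.2.1, _, hq, rfl⟩ this
    choose f hf using hleft
    refine hP.2 ⟨leafFront x H, _, f, isFront_leafFront hx hH hβ, ?_, fun s t hst hle => ?_⟩
    · simp
    · exact not_le_of_tri hx (hf s) (hf t) hst (Sum.inl_le_inl_iff.2 hle)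
  -- All leaves over `H` are the extra urelement. A sequence long enough that both it and its tail
  -- have reached leaves then contradicts reflexivity.
  · obtain ⟨a, ha⟩ := hH.nonempty
    obtain ⟨b, hb, hab⟩ := hH.exists_gt a
    obtain ⟨m, hm, ⟨q, hq⟩⟩ := exists_append_isUr hx (l := [b]) (hH.sdiff (Set.finite_Iic a))
      (by simp) ⟨by simp, by simpa using ⟨hb, hab⟩⟩
    have hs : IncIn H (a :: ([b] ++ m)) := by
      refine ⟨List.pairwise_cons.2 ⟨fun c hc => not_le.1 (hm.2 c hc).2, hm.1⟩, fun c hc => ?_⟩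
      rcases List.mem_cons.1 hc with rfl | hc
      · exact ha
      · exact (hm.2 c hc).1
    obtain ⟨m', hm', ⟨r, hr⟩⟩ := exists_append_isUr hx hH (by simp) hs
    have hq' := tree_append_eq_ur hx (by simp) hq m' (List.pairwise_cons.1 hm'.1).2
    have key := tree_not_le_tail hx (by simp) hm'.1
    have hright : ∀ l r, l ≠ [] → IncIn H l → tree x l = ur r → r.isRight := by
      intro l r hl hi hr
      by_contra hn
      exact h l hi ⟨hl, r, hr, hn⟩
    have h₁ := hright _ _ (by simp) hm' hr
    have h₂ := hright _ _ (by simp) ⟨(List.pairwise_cons.1 hm'.1).2,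
      fun c hc => hm'.2 c (List.mem_cons_of_mem _ hc)⟩ hq'
    rw [List.cons_append, List.tail_cons, hq', ← List.cons_append, hr] at key
    refine key PUnit.unit (le_ur_ur.2 ?_)
    obtain ⟨r, rfl⟩ := Sum.isRight_iff.1 h₁
    obtain ⟨q, rfl⟩ := Sum.isRight_iff.1 h₂
    exact Sum.inr_le_inr_iff.2 le_rfl

end IterIdeal

namespace IterIdeal

open V

variable {P : Type u} [Preorder P]

/-! ### The atoms are well quasi-ordered -/

/-- The set of the `f i` together with the additional urelement. -/
def starCode {ι : Type u} (f : ι → V (P ⊕ PUnit.{u + 1})) : V (P ⊕ PUnit.{u + 1}) :=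
  V.set (Option ι) fun o => o.elim (ur (.inr PUnit.unit)) f

theorem le_starCode {ι : Type u} (f : ι → V (P ⊕ PUnit.{u + 1})) (i : ι) : Le (f i) (starCode f) :=
  el_le (starCode f) (some i)

theorem ur_le_starCode {ι : Type u} (f : ι → V (P ⊕ PUnit.{u + 1})) :
    Le (ur (.inr PUnit.unit)) (starCode f) :=
  el_le (starCode f) none

/-- `c` codes the atom `x` as a set over `P` and one additional urelement, which marks stars. -/
inductive Code : V (FinSeq P) → V (P ⊕ PUnit.{u + 1}) → Prop
  | ideal (x : V P) (hx : Her x) : Code (map FinSeq.single x) (map Sum.inl x)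
  | star {β : Ordinal.{u}} {X : Set (V (FinSeq P))} {x : V (FinSeq P)} (h : IsStar β X x)
      {ι : Type u} (y : ι → V (FinSeq P)) (f : ι → V (P ⊕ PUnit.{u + 1})) (hy : ∀ i, y i ∈ X)
      (hX : ∀ z ∈ X, ∃ i, Le z (y i)) (hf : ∀ i, Code (y i) (f i)) :
      Code x (starCode f)

theorem exists_ur_le_map_inl {x : V P} (hx : Her x) :
    ∃ p, Le (ur (.inl p)) (map (Sum.inl : P → P ⊕ PUnit.{u + 1}) x) := by
  obtain ⟨p, hp⟩ := exists_ur_le hx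
  exact ⟨p, (V.map_le_map_iff (x := ur p) fun _ _ => Sum.inl_le_inl_iff).2 hp⟩

theorem Code.exists_ur_le {x : V (FinSeq P)} {c : V (P ⊕ PUnit.{u + 1})} (h : Code x c) :
    ∃ p, Le (ur (.inl p)) c := by
  induction h with
  | ideal x hx => exact exists_ur_le_map_inl hx
  | star h y f hy hX hf ih =>
    obtain ⟨z, hz⟩ := h.1.1
    obtain ⟨i, -⟩ := hX z hz
    obtain ⟨p, hp⟩ := ih i
    exact ⟨p, V.le_trans hp (le_starCode f i)⟩

/-- Replace the letters of a product over `X` one by one by larger letters from `Y`. -/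
theorem exists_star_le_star {β γ : Ordinal.{u}} {X Y : Set (V (FinSeq P))} {x y : V (FinSeq P)}
    (hx : IsStar β X x) (hy : IsStar γ Y y) (h : ∀ a ∈ X, ∃ b ∈ Y, Le a b) : Le x y := by
  refine le_iff.2 fun k => ?_
  obtain ⟨-, l, hl, hkl⟩ := hx.el_mem k
  obtain ⟨m, hm, hlm⟩ : ∃ m : List (V (FinSeq P)), (∀ b ∈ m, b ∈ Y) ∧
      Le (listProd l) (listProd m) := by
    clear hkl
    induction l with
    | nil => exact ⟨[], by simp, V.le_refl _⟩
    | cons a l ih =>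
      rw [List.forall_mem_cons] at hl
      obtain ⟨b, hb, hab⟩ := h a hl.1
      obtain ⟨m, hm, hlm⟩ := ih hl.2
      exact ⟨b :: m, List.forall_mem_cons.2 ⟨hb, hm⟩, mul_mono hab hlm⟩
  have hstar : listProd m ∈ star γ Y :=
    ⟨listProd_mem_iterIdeal fun b hb => atoms_subset (hy.1.2.1 (hm b hb)), m, hm, Sim.refl _⟩
  obtain ⟨j, hj⟩ := hy.exists_el hstar
  exact ⟨j, V.le_trans hkl.1 (V.le_trans hlm hj.le)⟩

/-- The mark prevents the code of a star from lying below that of an ideal over `P`. It bounds no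
code or element of an ideal code, as these lie above urelements from `P`; so comparisons with a star
code are realized by genuine members of its `X`, where induction applies. -/
theorem Code.le_of_le {x y : V (FinSeq P)} {c d : V (P ⊕ PUnit.{u + 1})} (hx : Code x c)
    (hy : Code y d) (h : Le c d) : Le x y := by
  have hid : ∀ a b : V P, Le (map (Sum.inl : P → P ⊕ PUnit.{u + 1}) a) (map Sum.inl b) →
      Le (map FinSeq.single a) (map FinSeq.single b) := fun a b hab =>
    (V.map_le_map_iff fun _ _ => FinSeq.single_le_single).2
      ((V.map_le_map_iff fun _ _ => Sum.inl_le_inl_iff).1 hab)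
  refine induction₂ (motive := fun c d : V (P ⊕ PUnit.{u + 1}) => ∀ x y, Code x c → Code y d →
    Le c d → Le x y) ?_ ?_ c d x y hx hy h
  · intro p q x y hx hy h
    generalize hc : ur p = c at hx h
    generalize hd : ur q = d at hy h
    cases hx with
    | star => cases hc
    | ideal a ha => cases hy with
      | star => cases hd
      | ideal b hb => exact hid a b h
  · intro c d ih x y hx hy h
    cases hx with
    | ideal a ha => cases hy with
      | ideal b hb => exact hid a b h
      | star hs y f hy hX hf =>
        refine map_le_iff.2 fun i => ?_
        obtain ⟨o, ho⟩ := map_le_iff.1 h i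
        cases o with
        | none =>
          obtain ⟨p, hp⟩ := exists_ur_le_map_inl ((her_iff.1 ha).2.1 i)
          exact absurd (le_ur_ur.1 (V.le_trans hp ho)) Sum.not_inl_le_inr
        | some j =>
          obtain ⟨k, hk⟩ := exists_el_map (φ := (Sum.inl : P → P ⊕ PUnit.{u + 1})) a i
          have := ih k (some j) (map FinSeq.single (a.el i)) (y j)
            (hk ▸ Code.ideal _ ((her_iff.1 ha).2.1 i)) (hf j) (hk ▸ ho)
          obtain ⟨l, hl⟩ := hs.exists_el (mem_star_of_mem (hy j) (atoms_subset (hs.1.2.1 (hy j))))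
          exact ⟨l, V.le_trans this hl.le⟩
    | star hs y f hy' hX hf => cases hy with
      | ideal b hb =>
        obtain ⟨q, hq⟩ := ur_le_map (V.le_trans (ur_le_starCode f) h)
        exact absurd hq Sum.not_inr_le_inl
      | star hs' y' f' hy'' hX' hf' =>
        refine exists_star_le_star hs hs' fun a ha => ?_
        obtain ⟨i, hi⟩ := hX a ha
        obtain ⟨o, ho⟩ := le_iff.1 h (some i)
        cases o with
        | none =>
          obtain ⟨p, hp⟩ := (hf i).exists_ur_le
          exact absurd (le_ur_ur.1 (V.le_trans hp ho)) Sum.not_inl_le_inr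
        | some j => exact ⟨y' j, hy'' j, V.le_trans hi (ih (some i) (some j) _ _ (hf i) (hf' j) ho)⟩

/-- A star in `S_β(P)` is formed from atoms of a level `γ < β`, so its code has depth at most `γ + 1
≤ β`. Smallness of the class of representatives lets the code be a set. -/
theorem exists_code {β : Ordinal.{u}} {x : V (FinSeq P)} (hx : x ∈ atoms P β) :
    ∃ c, Code x c ∧ depth c ≤ β := by
  induction β using WellFoundedLT.induction generalizing x with
  | ind β ih =>
  rcases hx with hx | ⟨x, hx, rfl⟩
  · obtain ⟨γ, hγ, X, h⟩ := mem_starHier.1 hx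
    obtain ⟨ι, y, hy, hyX⟩ := exists_small_family (C := X) (γ := γ)
      fun z hz => (mem_iterIdeal.1 (atoms_subset (h.1.2.1 hz))).2
    choose f hf hfd using fun i => ih γ hγ (h.1.2.1 (hy i))
    refine ⟨_, Code.star h y f hy (fun z hz => ?_) hf, ?_⟩
    · obtain ⟨i, hi⟩ := hyX z hz
      exact ⟨i, hi.le⟩
    · refine (depth_le_succ_iff.2 fun o => ?_).trans (Order.succ_le_of_lt hγ)
      cases o with
      | none => simp [starCode, el, depth]
      | some i => exact hfd i
  · rw [mem_iterIdeal] at hx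
    exact ⟨_, Code.ideal x hx.1, (depth_map x).trans_le hx.2⟩

theorem exists_le_of_atoms {β : Ordinal.{u}} (hP : IsAlphaWqo P (β + 1)) (a : ℕ → V (FinSeq P))
    (ha : ∀ n, a n ∈ atoms P β) : ∃ i j, i < j ∧ Le (a i) (a j) := by
  choose c hc hd using fun n => exists_code (ha n)
  obtain ⟨i, j, hij, h⟩ := exists_le_of_isAlphaWqo hP c hd
  exact ⟨i, j, hij, (hc i).le_of_le (hc j) h⟩

end IterIdeal

namespace IterIdeal

/-! ### Ideals of well quasi-ordered monoids -/

section monoid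

/-- In a strictly descending sequence, pick `a n` lost at step `n`. If `a i ≤ a j` with `i < j`,
then `a i` still belongs to the next lower set, a contradiction. -/
theorem wellFoundedLT_lowerSet {T : Type*} [Preorder T] [WellQuasiOrderedLE T] :
    WellFoundedLT (LowerSet T) := by
  refine ⟨RelEmbedding.wellFounded_iff_isEmpty.2 ⟨fun f => ?_⟩⟩
  have hlt : ∀ i j, i < j → f j < f i := fun i j hij => f.map_rel_iff.2 hij
  choose a ha ha' using fun n => Set.exists_of_ssubset (LowerSet.coe_ssubset_coe.2
    (hlt n (n + 1) n.lt_succ_self))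
  obtain ⟨i, j, hij, h⟩ := wellQuasiOrdered_le a
  refine ha' i ((f (i + 1)).lower h ?_)
  rcases (Nat.succ_le_of_lt hij).lt_or_eq with hlt' | heq
  · exact (hlt _ _ hlt').le (ha j)
  · subst heq
    exact ha _

variable {A M : Type*} [Preorder M]

/-- If the image of a lower set of a well quasi-order is cofinal in an ideal, then so is the image
of some ideal inside the lower set. -/
theorem exists_ideal_cofinal {T : Type*} [Preorder T] [WellQuasiOrderedLE T] {φ : T → M}
    (D : Order.Ideal M) (S : LowerSet T)
    (hS : ∀ d ∈ D, ∃ t ∈ S, d ≤ φ t) :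
    ∃ I : Order.Ideal T, (∀ t ∈ I, t ∈ S) ∧ ∀ d ∈ D, ∃ t ∈ I, d ≤ φ t := by
  have := wellFoundedLT_lowerSet (T := T)
  induction S using WellFoundedLT.induction with
  | ind S ih =>
  by_cases hdir : DirectedOn (· ≤ ·) (S : Set T)
  · obtain ⟨d, hd⟩ := D.nonempty
    obtain ⟨t, ht, -⟩ := hS d hd
    exact ⟨⟨S, ⟨t, ht⟩, hdir⟩, fun t ht => ht, hS⟩
  · simp only [DirectedOn, not_forall, not_exists, not_and] at hdir
    obtain ⟨a, ha, b, hb, hab⟩ := hdir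
    -- The upper cone of `c` may be removed if the rest stays cofinal. If this failed for both `a`
    -- and `b`, some `t` in `S` would be above both, which their choice excludes.
    have hsub : ∀ c ∈ S, (∀ d ∈ D, ∃ t ∈ S, ¬ c ≤ t ∧ d ≤ φ t) →
        ∃ I : Order.Ideal T, (∀ t ∈ I, t ∈ S) ∧ ∀ d ∈ D, ∃ t ∈ I, d ≤ φ t := by
      intro c hc h
      let S' : LowerSet T := ⟨{t | t ∈ S ∧ ¬ c ≤ t},
        fun s t hts hs => ⟨S.lower hts hs.1, fun hct => hs.2 (hct.trans hts)⟩⟩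
      have hlt : S' < S := lt_of_le_not_ge (fun t ht => ht.1) fun hle => (hle hc).2 le_rfl
      obtain ⟨I, hI, hD⟩ := ih S' hlt fun d hd => by
        obtain ⟨t, ht, hct, hdt⟩ := h d hd
        exact ⟨t, ⟨ht, hct⟩, hdt⟩
      exact ⟨I, fun t ht => (hI t ht).1, hD⟩
    by_contra hn
    have h₁ := mt (hsub a ha) hn
    have h₂ := mt (hsub b hb) hn
    push Not at h₁ h₂
    obtain ⟨d, hd, h₁⟩ := h₁
    obtain ⟨e, he, h₂⟩ := h₂
    obtain ⟨f, hf, hdf, hef⟩ := D.directed d hd e he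
    obtain ⟨t, ht, hft⟩ := hS f hf
    have hat : a ≤ t := by
      by_contra hat
      exact h₁ t ht hat (hdf.trans hft)
    have hbt : b ≤ t := by
      by_contra hbt
      exact h₂ t ht hbt (hef.trans hft)
    exact hab t ht hat hbt

variable [Preorder A] [Monoid M] [MulLeftMono M] [MulRightMono M]
  {φ : A → M}

theorem prod_map_le_prod_map (h1 : ∀ m : M, 1 ≤ m) (hφ : Monotone φ) {l m : List A}
    (h : List.SublistForall₂ (· ≤ ·) l m) : (l.map φ).prod ≤ (m.map φ).prod := by
  induction h with
  | nil => exact h1 _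
  | cons h _ ih => simpa using mul_le_mul' (hφ h) ih
  | cons_right _ ih => simpa using ih.trans (le_mul_of_one_le_left' (h1 _))

variable [WellQuasiOrderedLE A]

/-- Higman's lemma for words over `A`, transferred along the monotone evaluation of words. -/
theorem wellQuasiOrderedLE_of_generated (h1 : ∀ m : M, 1 ≤ m) (hφ : Monotone φ)
    (gen : ∀ m : M, ∃ l : List A, (l.map φ).prod = m) : WellQuasiOrderedLE M := by
  refine ⟨fun f => ?_⟩
  choose l hl using fun n => gen (f n)
  have := Set.PartiallyWellOrderedOn.partiallyWellOrderedOn_sublistForall₂ (α := A) (· ≤ ·)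
    (s := Set.univ) (Set.isPWO_of_wellQuasiOrderedLE Set.univ)
  obtain ⟨i, j, hij, h⟩ := this fun n => ⟨l n, fun _ _ => Set.mem_univ _⟩
  refine ⟨i, j, hij, ?_⟩
  rw [← hl i, ← hl j]
  exact prod_map_le_prod_map h1 hφ h

/-- An induction principle for the ideals of a monoid with least element `1` that is generated by a
well quasi-order: an ideal that is not closed under products is a product `F · G · H` with smaller
ideals `F`, `H` and an ideal `G` of generators. -/
theorem ideal_induction (h1 : ∀ m : M, 1 ≤ m) (hφ : Monotone φ)
    (gen : ∀ m : M, ∃ l : List A, (l.map φ).prod = m) {C : Order.Ideal M → Prop}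
    (idem : ∀ D : Order.Ideal M, (∀ u ∈ D, ∀ v ∈ D, u * v ∈ D) → C D)
    (prod : ∀ (D F H : Order.Ideal M) (G : Order.Ideal A), C F → C H →
      (∀ u ∈ F, ∀ a ∈ G, ∀ v ∈ H, u * φ a * v ∈ D) →
      (∀ d ∈ D, ∃ u ∈ F, ∃ a ∈ G, ∃ v ∈ H, d ≤ u * φ a * v) → C D)
    (D : Order.Ideal M) : C D := by
  have hwqo := wellQuasiOrderedLE_of_generated h1 hφ gen
  have hwf := (InvImage.wf Order.Ideal.toLowerSet (wellFoundedLT_lowerSet (T := M)).wf)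
  induction D using hwf.induction with
  | _ D ih =>
  by_cases hD : ∀ u ∈ D, ∀ v ∈ D, u * v ∈ D
  · exact idem D hD
  push Not at hD
  obtain ⟨u, hu, v, hv, huv⟩ := hD
  obtain ⟨d, hd, hud, hvd⟩ := D.directed u hu v hv
  have hdd : d * d ∉ D := fun h => huv (D.lower (mul_le_mul' hud hvd) h)
  have hleft : ∀ u v : M, u ≤ u * v := fun u v => le_mul_of_one_le_right' (h1 v)
  have hright : ∀ u v : M, v ≤ u * v := fun u v => le_mul_of_one_le_left' (h1 u)
  have hd1 : ¬ d ≤ 1 := fun h => hdd (D.lower (mul_le_mul' h le_rfl) (by rwa [one_mul]))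
  -- Cut the word at the first letter with which its prefix gets above `d`.
  have split : ∀ l : List A, d ≤ (l.map φ).prod → ∃ u a v, (l.map φ).prod = u * φ a * v ∧
      ¬ d ≤ u ∧ d ≤ u * φ a := by
    intro l hl
    induction l using List.reverseRecOn with
    | nil => exact absurd hl hd1
    | append_singleton l a ihl =>
      rw [List.map_append, List.prod_append, List.map_singleton, List.prod_singleton] at hl ⊢
      by_cases hl' : d ≤ (l.map φ).prod
      · obtain ⟨u, b, v, h, hu, hub⟩ := ihl hl'
        exact ⟨u, b, v * φ a, by rw [h, mul_assoc], hu, hub⟩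
      · exact ⟨_, a, 1, (mul_one _).symm, hl', hl⟩
  -- Excluding `d` from the outer coordinates makes `F` and `H` smaller than `D`. Such triples are
  -- still cofinal: after the cut above, `d ≤ v` would put `d * d` below an element of `D`.
  let S : LowerSet (M × A × M) := ⟨{t | t.1 * φ t.2.1 * t.2.2 ∈ D ∧ ¬ d ≤ t.1 ∧ ¬ d ≤ t.2.2},
    fun s t hts hs => ⟨D.lower (mul_le_mul' (mul_le_mul' hts.1 (hφ hts.2.1)) hts.2.2) hs.1,
      fun h => hs.2.1 (h.trans hts.1), fun h => hs.2.2 (h.trans hts.2.2)⟩⟩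
  obtain ⟨I, hI, hcof⟩ := exists_ideal_cofinal (φ := fun t : M × A × M => t.1 * φ t.2.1 * t.2.2)
    D S (by
      intro z hz
      obtain ⟨z', hz', hzz', hdz'⟩ := D.directed z hz d hd
      obtain ⟨l, rfl⟩ := gen z'
      obtain ⟨u, a, v, h, hu, hua⟩ := split l hdz'
      refine ⟨(u, a, v), ⟨h ▸ hz', hu, fun hdv => hdd (D.lower ?_ hz')⟩, h ▸ hzz'⟩
      rw [h]
      exact mul_le_mul' hua hdv)
  obtain ⟨⟨u₀, a₀, v₀⟩, h₀⟩ := I.nonempty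
  let F : Order.Ideal M := ⟨⟨{u | ∃ a v, (u, a, v) ∈ I}, fun u u' hu ⟨a, v, h⟩ =>
    ⟨a, v, I.lower (show (u', a, v) ≤ (u, a, v) from ⟨hu, le_rfl⟩) h⟩⟩, ⟨u₀, a₀, v₀, h₀⟩, by
    rintro u ⟨a, v, h⟩ u' ⟨a', v', h'⟩
    obtain ⟨⟨u'', a'', v''⟩, h'', h₁, h₂⟩ := I.directed _ h _ h'
    exact ⟨u'', ⟨a'', v'', h''⟩, h₁.1, h₂.1⟩⟩
  let G : Order.Ideal A := ⟨⟨{a | ∃ u v, (u, a, v) ∈ I}, fun a a' ha ⟨u, v, h⟩ =>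
    ⟨u, v, I.lower (show (u, a', v) ≤ (u, a, v) from ⟨le_rfl, ha, le_rfl⟩) h⟩⟩,
    ⟨a₀, u₀, v₀, h₀⟩, by
    rintro a ⟨u, v, h⟩ a' ⟨u', v', h'⟩
    obtain ⟨⟨u'', a'', v''⟩, h'', h₁, h₂⟩ := I.directed _ h _ h'
    exact ⟨a'', ⟨u'', v'', h''⟩, h₁.2.1, h₂.2.1⟩⟩
  let H : Order.Ideal M := ⟨⟨{v | ∃ u a, (u, a, v) ∈ I}, fun v v' hv ⟨u, a, h⟩ =>
    ⟨u, a, I.lower (show (u, a, v') ≤ (u, a, v) from ⟨le_rfl, le_rfl, hv⟩) h⟩⟩,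
    ⟨v₀, u₀, a₀, h₀⟩, by
    rintro v ⟨u, a, h⟩ v' ⟨u', a', h'⟩
    obtain ⟨⟨u'', a'', v''⟩, h'', h₁, h₂⟩ := I.directed _ h _ h'
    exact ⟨v'', ⟨u'', a'', h''⟩, h₁.2.2, h₂.2.2⟩⟩
  have hFD : F.toLowerSet < D.toLowerSet := by
    refine lt_of_le_not_ge ?_ fun hle => ?_
    · rintro u ⟨a, v, h⟩
      exact D.lower ((hleft u _).trans (hleft _ v)) (hI _ h).1
    · obtain ⟨a, v, h⟩ := hle hd
      exact (hI _ h).2.1 le_rfl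
  have hHD : H.toLowerSet < D.toLowerSet := by
    refine lt_of_le_not_ge ?_ fun hle => ?_
    · rintro v ⟨u, a, h⟩
      exact D.lower (hright _ v) (hI _ h).1
    · obtain ⟨u, a, h⟩ := hle hd
      exact (hI _ h).2.2 le_rfl
  refine prod D F H G (ih F hFD) (ih H hHD) ?_ ?_
  -- Coordinates taken from three different triples are dominated by one triple, because `I` is
  -- directed in the product order.
  · rintro u ⟨a, v, h⟩ a' ⟨u', v', h'⟩ v'' ⟨u'', a'', h''⟩
    obtain ⟨t, ht, h₁, h₂⟩ := I.directed _ h _ h'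
    obtain ⟨t', ht', h₃, h₄⟩ := I.directed _ ht _ h''
    refine (hI _ (I.lower (show (u, a', v'') ≤ t' from ?_) ht')).1
    exact ⟨h₁.1.trans h₃.1, h₂.2.1.trans h₃.2.1, h₄.2.2⟩
  · intro z hz
    obtain ⟨⟨u, a, v⟩, h, hle⟩ := hcof z hz
    exact ⟨u, ⟨a, v, h⟩, a, ⟨u, v, h⟩, v, ⟨u, a, h⟩, hle⟩

end monoid

end IterIdeal

namespace IterIdeal

open V

variable {P : Type u} [Preorder P]

/-! ### Words over the atoms -/

instance (Q : Type u) [Preorder Q] : Preorder (V Q) where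
  le := Le
  le_refl := V.le_refl
  le_trans _ _ _ := V.le_trans

/-- Words over the atoms of level `β`, ordered by the values of the products. -/
def Word (P : Type u) [Preorder P] (β : Ordinal.{u}) : Type (u + 1) := FreeMonoid (atoms P β)

/-- Products of sets satisfy the monoid laws only up to `∼*`; words satisfy them strictly, as
`ideal_induction` requires. -/
instance (β : Ordinal.{u}) : Monoid (Word P β) := inferInstanceAs (Monoid (FreeMonoid (atoms P β)))

namespace Word

variable {β : Ordinal.{u}}

/-- The letters of a word, as sets. -/
def letters (w : Word P β) : List (V (FinSeq P)) :=
  List.map Subtype.val (show List (atoms P β) from w)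

/-- The product of the letters of a word. -/
def val (w : Word P β) : V (FinSeq P) := listProd w.letters

/-- The word with the single letter `a`. -/
def of (a : atoms P β) : Word P β := FreeMonoid.of a

theorem letters_mul (v w : Word P β) : (v * w).letters = v.letters ++ w.letters :=
  List.map_append

theorem mem_atoms_of_mem_letters {w : Word P β} {x : V (FinSeq P)} (h : x ∈ w.letters) :
    x ∈ atoms P β := by
  obtain ⟨a, -, rfl⟩ := List.mem_map.1 h
  exact a.2

theorem exists_letters_eq (l : List (V (FinSeq P))) (hl : ∀ x ∈ l, x ∈ atoms P β) :
    ∃ w : Word P β, w.letters = l := by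
  lift l to List (atoms P β) using hl
  exact ⟨l, rfl⟩

theorem val_mem (w : Word P β) : w.val ∈ iterIdeal (FinSeq P) β :=
  listProd_mem_iterIdeal fun _ h => atoms_subset (mem_atoms_of_mem_letters h)

theorem val_her (w : Word P β) : Her w.val := (mem_iterIdeal.1 w.val_mem).1

theorem val_mul (v w : Word P β) : Sim (v * w).val (mul v.val w.val) := by
  rw [val, letters_mul]
  exact listProd_append _ _

theorem val_of (a : atoms P β) : Sim (of a).val a := listProd_singleton a.1

instance : Preorder (Word P β) := Preorder.lift val

instance : MulLeftMono (Word P β) := ⟨fun u _ _ h =>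
  V.le_trans (val_mul u _).1 (V.le_trans (mul_mono (V.le_refl _) h) (val_mul u _).2)⟩

instance : MulRightMono (Word P β) := ⟨fun u _ _ h =>
  V.le_trans (val_mul _ u).1 (V.le_trans (mul_mono h (V.le_refl _)) (val_mul _ u).2)⟩

protected theorem one_le (w : Word P β) : 1 ≤ w := one_le w.val_her

theorem monotone_of : Monotone (of : atoms P β → Word P β) := fun a b h =>
  V.le_trans (val_of a).1 (V.le_trans h (val_of b).2)

theorem exists_prod_map_of (w : Word P β) : ∃ l : List (atoms P β), (l.map of).prod = w := by
  refine ⟨show List (atoms P β) from w, ?_⟩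
  induction (show List (atoms P β) from w) with
  | nil => rfl
  | cons a l ih =>
    rw [List.map_cons, List.prod_cons, ih]
    rfl

theorem of_le_of_mem_letters {w : Word P β} (a : atoms P β) (h : a.1 ∈ w.letters) : of a ≤ w :=
  V.le_trans (val_of a).1
    (le_listProd (fun _ hy => her_of_mem_atoms (mem_atoms_of_mem_letters hy)) h)

end Word

/-! ### Representing ideals by sets -/

/-- The elements of `z` and the members of `S` are mutually cofinal. -/
def Represents {Q : Type u} [Preorder Q] (z : V Q) (S : Set (V Q)) : Prop :=
  (∀ i, ∃ s ∈ S, Le (z.el i) s) ∧ ∀ s ∈ S, ∃ i, Le s (z.el i)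

namespace Represents

theorem congr {Q : Type u} [Preorder Q] {z z' : V Q} {S T : Set (V Q)} (h : Represents z S)
    (hz : Sim z z') (hST : ∀ s ∈ S, ∃ t ∈ T, Le s t) (hTS : ∀ t ∈ T, ∃ s ∈ S, Le t s) :
    Represents z' T := by
  constructor
  · intro j
    obtain ⟨i, hi⟩ := le_iff.1 hz.2 j
    obtain ⟨s, hs, his⟩ := h.1 i
    obtain ⟨t, ht, hst⟩ := hST s hs
    exact ⟨t, ht, V.le_trans hi (V.le_trans his hst)⟩
  · intro t ht
    obtain ⟨s, hs, hts⟩ := hTS t ht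
    obtain ⟨i, hi⟩ := h.2 s hs
    obtain ⟨j, hj⟩ := le_iff.1 hz.1 i
    exact ⟨j, V.le_trans hts (V.le_trans hi hj)⟩

theorem sim {Q : Type u} [Preorder Q] {z z' : V Q} {S : Set (V Q)} (h : Represents z S)
    (h' : Represents z' S) : Sim z z' := by
  have key : ∀ {z z' : V Q}, Represents z S → Represents z' S → Le z z' := by
    intro z z' h h'
    refine le_iff.2 fun i => ?_
    obtain ⟨s, hs, his⟩ := h.1 i
    obtain ⟨j, hj⟩ := h'.2 s hs
    exact ⟨j, V.le_trans his hj⟩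
  exact ⟨key h h', key h' h⟩

theorem mul {z z' : V (FinSeq P)} {S T : Set (V (FinSeq P))} (h : Represents z S)
    (h' : Represents z' T) : Represents (mul z z') (Set.image2 mul S T) := by
  constructor
  · intro k
    obtain ⟨i, j, hk⟩ := exists_of_el_mul z z' k
    obtain ⟨s, hs, his⟩ := h.1 i
    obtain ⟨t, ht, hjt⟩ := h'.1 j
    exact ⟨_, Set.mem_image2_of_mem hs ht, hk ▸ mul_mono his hjt⟩
  · rintro _ ⟨s, hs, t, ht, rfl⟩
    obtain ⟨i, hi⟩ := h.2 s hs
    obtain ⟨j, hj⟩ := h'.2 t ht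
    obtain ⟨k, hk⟩ := exists_el_mul z z' i j
    exact ⟨k, hk ▸ mul_mono hi hj⟩

end Represents

/-- `S` is represented by a finite product of atoms of level `β`. -/
def RepresentedByAtoms (β : Ordinal.{u}) (S : Set (V (FinSeq P))) : Prop :=
  ∃ l : List (V (FinSeq P)), (∀ x ∈ l, x ∈ atoms P β) ∧ Represents (listProd l) S

variable {β : Ordinal.{u}}

theorem RepresentedByAtoms.congr {S T : Set (V (FinSeq P))} (h : RepresentedByAtoms β S)
    (hST : ∀ s ∈ S, ∃ t ∈ T, Le s t) (hTS : ∀ t ∈ T, ∃ s ∈ S, Le t s) :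
    RepresentedByAtoms β T := by
  obtain ⟨l, hl, h⟩ := h
  exact ⟨l, hl, h.congr (Sim.refl _) hST hTS⟩

theorem RepresentedByAtoms.mul {S T : Set (V (FinSeq P))} (h : RepresentedByAtoms β S)
    (h' : RepresentedByAtoms β T) : RepresentedByAtoms β (Set.image2 mul S T) := by
  obtain ⟨l, hl, h⟩ := h
  obtain ⟨m, hm, h'⟩ := h'
  refine ⟨l ++ m, fun x hx => (List.mem_append.1 hx).elim (hl x) (hm x),
    (h.mul h').congr (listProd_append l m).symm ?_ ?_⟩ <;>
  exact fun s hs => ⟨s, hs, V.le_refl s⟩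

theorem representedByAtoms_of_atom {x : V (FinSeq P)} (hx : x ∈ atoms P β)
    {S : Set (V (FinSeq P))} (h : Represents x S) : RepresentedByAtoms β S := by
  refine ⟨[x], by simpa using hx, h.congr (listProd_singleton x).symm ?_ ?_⟩ <;>
  exact fun s hs => ⟨s, hs, V.le_refl s⟩

/-- Every `X^*` exists as a set. -/
theorem exists_isStar {X : Set (V (FinSeq P))} (hX : X ∈ dotD (atoms P β)) :
    ∃ x, IsStar β X x := by
  obtain ⟨ι, f, hf, hfX⟩ := exists_small_family (C := star β X) (γ := β)
    fun y hy => (mem_iterIdeal.1 hy.1).2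
  refine ⟨V.set ι f, hX, fun y => ⟨fun ⟨i, hi⟩ => ?_, hfX y⟩⟩
  obtain ⟨h, l, hl, hil⟩ := hf i
  exact ⟨hi.symm.mem_iterIdeal h, l, hl, hi.sim.trans hil⟩

/-- An ideal closed under products is generated by the letters it contains: with `X` the class of
these atoms, the values of `D` are cofinal with `X^*`. -/
theorem representedByAtoms_of_idem (D : Order.Ideal (Word P β)) (hD : ∀ u ∈ D, ∀ v ∈ D, u * v ∈ D) :
    RepresentedByAtoms (β + 1) (Word.val '' (D : Set (Word P β))) := by
  have h1 : (1 : Word P β) ∈ D := by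
    obtain ⟨w, hw⟩ := D.nonempty
    exact D.lower (Word.one_le w) hw
  let X : Set (V (FinSeq P)) := {x | ∃ h : x ∈ atoms P β, Word.of ⟨x, h⟩ ∈ D}
  have hletters : ∀ w ∈ D, ∀ x ∈ w.letters, x ∈ X := fun w hw x hx =>
    ⟨Word.mem_atoms_of_mem_letters hx, D.lower (Word.of_le_of_mem_letters ⟨x, _⟩ hx) hw⟩
  have hmem : ∀ l : List (V (FinSeq P)), (∀ x ∈ l, x ∈ X) → ∃ w ∈ D, Le (listProd l) w.val := by
    intro l hl
    induction l with
    | nil => exact ⟨1, h1, V.le_refl _⟩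
    | cons x l ih =>
      rw [List.forall_mem_cons] at hl
      obtain ⟨⟨hx, hxD⟩, hl⟩ := hl
      obtain ⟨w, hw, hlw⟩ := ih hl
      exact ⟨_, hD _ hxD w hw,
        V.le_trans (mul_mono (Word.val_of ⟨x, hx⟩).2 hlw) (Word.val_mul _ _).2⟩
  rcases X.eq_empty_or_nonempty with hX | hX
  -- Here `D` contains only the empty word, and the urelement `1`, read as `{1}`, represents it as
  -- the empty product.
  · refine ⟨[], by simp, fun _ => ⟨_, ⟨1, h1, rfl⟩, V.le_refl _⟩, ?_⟩
    rintro _ ⟨w, hw, rfl⟩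
    refine ⟨PUnit.unit, ?_⟩
    have : w.letters = [] := List.eq_nil_iff_forall_not_mem.2 fun x hx => by
      simpa [hX] using hletters w hw x hx
    rw [Word.val, this]
    exact V.le_refl _
  · obtain ⟨x, hx⟩ := exists_isStar (β := β) (X := X) ⟨hX, fun x hx => hx.choose,
      fun y ⟨hy, hyD⟩ z hz hzy => ⟨hz, D.lower (Word.monotone_of (a := ⟨z, hz⟩) hzy) hyD⟩⟩
    refine representedByAtoms_of_atom
      (.inl (mem_starHier.2 ⟨β, Order.lt_succ β, X, hx⟩)) ⟨fun i => ?_, ?_⟩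
    · obtain ⟨-, l, hl, hil⟩ := hx.el_mem i
      obtain ⟨w, hw, hlw⟩ := hmem l hl
      exact ⟨_, ⟨w, hw, rfl⟩, V.le_trans hil.1 hlw⟩
    · rintro _ ⟨w, hw, rfl⟩
      obtain ⟨i, hi⟩ := hx.exists_el
        (⟨w.val_mem, w.letters, hletters w hw, Sim.refl _⟩ : w.val ∈ star β X)
      exact ⟨i, hi.le⟩

/-- If stars are cofinal in `G`, their idempotency makes the words below members of `G` closed under
products, which is the previous case. Otherwise no star of `G` lies above some `a₀`, so the elements
of `İ*_β(P)` are cofinal in `G` and together form an element of `İ*_{β+1}(P)`. -/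
theorem representedByAtoms_of_ideal_atoms (G : Order.Ideal (atoms P β)) :
    RepresentedByAtoms (β + 1) (Subtype.val '' (G : Set (atoms P β))) := by
  by_cases hst : ∀ a ∈ G, ∃ b ∈ G, a ≤ b ∧ b.1 ∈ starHier P β
  · let D : Order.Ideal (Word P β) := ⟨⟨{w | ∃ a ∈ G, w ≤ Word.of a},
      fun w v hvw ⟨a, ha, hwa⟩ => ⟨a, ha, hvw.trans hwa⟩⟩,
      ⟨1, G.nonempty.choose, G.nonempty.choose_spec, Word.one_le _⟩, by
        rintro w ⟨a, ha, hwa⟩ v ⟨b, hb, hvb⟩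
        obtain ⟨c, hc, hac, hbc⟩ := G.directed a ha b hb
        exact ⟨Word.of c, ⟨c, hc, le_rfl⟩, hwa.trans (Word.monotone_of hac),
          hvb.trans (Word.monotone_of hbc)⟩⟩
    refine (representedByAtoms_of_idem D ?_).congr ?_ ?_
    · rintro u ⟨a, ha, hua⟩ v ⟨b, hb, hvb⟩
      obtain ⟨c, hc, hac, hbc⟩ := G.directed a ha b hb
      obtain ⟨d, hd, hcd, hds⟩ := hst c hc
      refine ⟨d, hd, (mul_le_mul' (hua.trans (Word.monotone_of (hac.trans hcd)))
        (hvb.trans (Word.monotone_of (hbc.trans hcd)))).trans ?_⟩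
      have h := Word.val_of d
      exact V.le_trans (Word.val_mul _ _).1 (V.le_trans (mul_mono h.1 h.1)
        (V.le_trans (isIdem_of_mem_starHier hds).1 h.2))
    · rintro _ ⟨w, ⟨a, ha, hwa⟩, rfl⟩
      exact ⟨_, ⟨a, ha, rfl⟩, V.le_trans hwa (Word.val_of a).1⟩
    · rintro _ ⟨a, ha, rfl⟩
      exact ⟨_, ⟨Word.of a, ⟨a, ha, le_rfl⟩, rfl⟩, (Word.val_of a).2⟩
  · push Not at hst
    obtain ⟨a₀, ha₀, hst⟩ := hst
    have hid : ∀ a ∈ G, ∃ x ∈ iterIdeal P β, ∃ b ∈ G, a ≤ b ∧ b.1 = map FinSeq.single x := by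
      intro a ha
      obtain ⟨b, hb, hab, h₀b⟩ := G.directed a ha a₀ ha₀
      obtain ⟨x, hx, hxb⟩ := b.2.resolve_left (hst b hb h₀b)
      exact ⟨x, hx, b, hb, hab, hxb.symm⟩
    obtain ⟨ι, f, hf, hfC⟩ := exists_small_family (γ := β)
      (C := {x : V P | x ∈ iterIdeal P β ∧ ∃ b ∈ G, b.1 = map FinSeq.single x})
      fun x hx => (mem_iterIdeal.1 hx.1).2
    have hcof : ∀ a ∈ G, ∃ i, Le a.1 (map FinSeq.single (f i)) := by
      intro a ha
      obtain ⟨x, hx, b, hb, hab, hbx⟩ := hid a ha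
      obtain ⟨i, hi⟩ := hfC x ⟨hx, b, hb, hbx⟩
      refine ⟨i, V.le_trans hab ?_⟩
      rw [hbx]
      exact (V.map_le_map_iff fun _ _ => FinSeq.single_le_single).2 hi.le
    have hx : V.set ι f ∈ iterIdeal P (β + 1) := by
      refine mem_iterIdeal.2 ⟨⟨⟨(hcof a₀ ha₀).choose⟩, fun i => (mem_iterIdeal.1 (hf i).1).1,
        fun i j => ?_⟩, (depth_le_succ_iff (x := V.set ι f)).2
          fun i => (mem_iterIdeal.1 (hf i).1).2⟩
      obtain ⟨-, b, hb, hbi⟩ := hf i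
      obtain ⟨-, c, hc, hcj⟩ := hf j
      obtain ⟨d, hd, hbd, hcd⟩ := G.directed b hb c hc
      obtain ⟨k, hk⟩ := hcof d hd
      refine ⟨k, ?_, ?_⟩
      · rw [← V.map_le_map_iff fun _ _ => FinSeq.single_le_single, ← hbi]
        exact V.le_trans hbd hk
      · rw [← V.map_le_map_iff fun _ _ => FinSeq.single_le_single, ← hcj]
        exact V.le_trans hcd hk
    refine representedByAtoms_of_atom (.inr ⟨_, hx, rfl⟩) ⟨fun i => ?_, ?_⟩
    · obtain ⟨-, b, hb, hbi⟩ := hf i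
      exact ⟨_, ⟨b, hb, rfl⟩, hbi ▸ V.le_refl _⟩
    · rintro _ ⟨a, ha, rfl⟩
      exact hcof a ha

/-- Representation is compatible with products, so the decomposition of an ideal into `F · G · H`
becomes a product of representing sets. -/
theorem representedByAtoms_ideal (hP : IsAlphaWqo P (β + 1)) (D : Order.Ideal (Word P β)) :
    RepresentedByAtoms (β + 1) (Word.val '' (D : Set (Word P β))) := by
  have : WellQuasiOrderedLE (atoms P β) :=
    ⟨fun a => exists_le_of_atoms hP (fun n => (a n).1) fun n => (a n).2⟩
  refine ideal_induction (φ := Word.of) Word.one_le Word.monotone_of Word.exists_prod_map_of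
    representedByAtoms_of_idem (fun D F H G hF hH hD hcof => ?_) D
  refine ((hF.mul (representedByAtoms_of_ideal_atoms G)).mul hH).congr ?_ ?_
  · rintro _ ⟨_, ⟨_, ⟨u, hu, rfl⟩, _, ⟨a, ha, rfl⟩, rfl⟩, _, ⟨v, hv, rfl⟩, rfl⟩
    exact ⟨_, ⟨_, hD u hu a ha v hv, rfl⟩, V.le_trans (mul_mono (V.le_trans
      (mul_mono (V.le_refl _) (Word.val_of a).2) (Word.val_mul _ _).2) (V.le_refl _))
      (Word.val_mul _ _).2⟩
  · rintro _ ⟨d, hd, rfl⟩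
    obtain ⟨u, hu, a, ha, v, hv, h⟩ := hcof d hd
    exact ⟨_, ⟨_, ⟨_, ⟨u, hu, rfl⟩, _, ⟨a, ha, rfl⟩, rfl⟩, _, ⟨v, hv, rfl⟩, rfl⟩,
      V.le_trans h (V.le_trans (Word.val_mul _ _).1 (mul_mono (V.le_trans (Word.val_mul _ _).1
        (mul_mono (V.le_refl _) (Word.val_of a).1)) (V.le_refl _)))⟩

theorem IsAlphaWqo.mono {α β : Ordinal.{u}} (h : IsAlphaWqo P α) (hβ : β ≤ α) :
    IsAlphaWqo P β :=
  ⟨h.1, fun ⟨F, rk, f, hF, hrk, hf⟩ => h.2 ⟨F, rk, f, hF, hrk.trans_le hβ, hf⟩⟩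

/-- The elements of `İ*_α(P^{<ω})` are finite products of atoms. -/
theorem exists_sim_listProd {α : Ordinal.{u}} (hP : IsAlphaWqo P (α + 1)) {x : V (FinSeq P)}
    (hx : x ∈ iterIdeal (FinSeq P) α) :
    ∃ l : List (V (FinSeq P)), (∀ y ∈ l, y ∈ atoms P α) ∧ Sim x (listProd l) := by
  induction α using WellFoundedLT.induction generalizing x with
  | ind α ih =>
  rw [mem_iterIdeal] at hx
  obtain ⟨hx, hxd⟩ := hx
  cases x with
  | ur w =>
    refine ⟨List.map (fun p => ur (FinSeq.single p)) (show List P from w), ?_, ?_⟩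
    · intro y hy
      obtain ⟨p, -, rfl⟩ := List.mem_map.1 hy
      exact .inr ⟨ur p, isUr_mem_iterIdeal (isUr_ur p) α, rfl⟩
    · have : listProd (List.map (fun p => ur (FinSeq.single p)) (show List P from w)) = ur w := by
        induction (show List P from w) with
        | nil => rfl
        | cons p l ih => exact (congrArg (mul (ur (FinSeq.single p))) ih).trans rfl
      rw [this]
      exact Sim.refl _
  | set ι f =>
    obtain ⟨β, hβα, hβ⟩ := (depth_le_iff ((zero_le.trans_lt (Order.lt_succ _)).trans_le hxd)).1 hxd
    have hP' : IsAlphaWqo P (β + 1) := hP.mono (add_le_add_left hβα.le 1)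
    have hw : ∀ i, ∃ w : Word P β, Sim (f i) w.val := by
      intro i
      obtain ⟨l, hl, hil⟩ := ih β hβα hP' (x := f i) (mem_iterIdeal.2 ⟨hx.2.1 i, hβ i⟩)
      obtain ⟨w, rfl⟩ := Word.exists_letters_eq l hl
      exact ⟨w, hil⟩
    choose w hw using hw
    -- The words naming the elements of the set are directed because the set is; their downward
    -- closure is the ideal to be represented.
    let D : Order.Ideal (Word P β) := ⟨⟨{v | ∃ i, v ≤ w i}, fun v u huv ⟨i, hi⟩ => ⟨i, huv.trans hi⟩⟩,
      ⟨w hx.1.some, hx.1.some, le_rfl⟩, by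
        rintro u ⟨i, hi⟩ v ⟨j, hj⟩
        obtain ⟨k, hik, hjk⟩ := hx.2.2 i j
        exact ⟨w k, ⟨k, le_rfl⟩,
          hi.trans (V.le_trans (hw i).2 (V.le_trans hik (hw k).1)),
          hj.trans (V.le_trans (hw j).2 (V.le_trans hjk (hw k).1))⟩⟩
    obtain ⟨l, hl, hrep⟩ := representedByAtoms_ideal hP' D
    refine ⟨l, fun y hy => atoms_mono (Order.succ_le_of_lt hβα) (hl y hy), ?_⟩
    have hset : Represents (V.set ι f) (Word.val '' (D : Set (Word P β))) := by
      refine ⟨fun i => ⟨_, ⟨w i, ⟨i, le_rfl⟩, rfl⟩, (hw i).1⟩, ?_⟩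
      rintro _ ⟨v, ⟨i, hi⟩, rfl⟩
      exact ⟨i, V.le_trans hi (hw i).2⟩
    exact hset.sim hrep

/-- Primality, applied factor by factor to a product of atoms, selects one of them; the empty
product is excluded as `x` is not equivalent to `1`. -/
theorem exists_atom_sim {α : Ordinal.{u}} (hP : IsAlphaWqo P (α + 1)) {x : V (FinSeq P)}
    (hx : IsPrimeIn α x) : ∃ y ∈ atoms P α, Sim x y := by
  obtain ⟨hxα, hx1, hprime⟩ := hx
  obtain ⟨l, hl, hxl⟩ := exists_sim_listProd hP hxα
  induction l with
  | nil => exact absurd hxl hx1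
  | cons y l ih =>
    rw [List.forall_mem_cons] at hl
    rcases hprime y (atoms_subset hl.1) (listProd l)
      (listProd_mem_iterIdeal fun z hz => atoms_subset (hl.2 z hz)) hxl with h | h
    · exact ⟨y, hl.1, h⟩
    · exact ih hl.2 h

end IterIdeal

theorem mainTheorem8 (P : Type u) [Preorder P] (α : Ordinal.{u})
    (hP : IterIdeal.IsAlphaWqo P (α + 1)) :
    (∀ x ∈ IterIdeal.idealsOf P α, IterIdeal.IsPrimeIn α x ∧ ¬ IterIdeal.IsIdem x) ∧
    (∀ x ∈ IterIdeal.starHier P α, IterIdeal.IsPrimeIn α x ∧ IterIdeal.IsIdem x) ∧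
    (∀ x : IterIdeal.V (IterIdeal.FinSeq P), IterIdeal.IsPrimeIn α x → ¬ IterIdeal.IsIdem x →
      ∃ y ∈ IterIdeal.idealsOf P α, IterIdeal.V.Sim x y) ∧
    (∀ x : IterIdeal.V (IterIdeal.FinSeq P), IterIdeal.IsPrimeIn α x → IterIdeal.IsIdem x →
      ∃ y ∈ IterIdeal.starHier P α, IterIdeal.V.Sim x y) := by
  refine ⟨fun x hx => ⟨IterIdeal.isPrimeIn_of_mem_idealsOf hx,
    IterIdeal.not_isIdem_of_mem_idealsOf hx⟩, fun x hx =>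
    ⟨IterIdeal.isPrimeIn_of_mem_starHier hx, IterIdeal.isIdem_of_mem_starHier hx⟩,
    fun x hx hidem => ?_, fun x hx hidem => ?_⟩
  · obtain ⟨y, hy | hy, hxy⟩ := IterIdeal.exists_atom_sim hP hx
    · exact absurd (IterIdeal.isIdem_congr hxy.symm (IterIdeal.isIdem_of_mem_starHier hy)) hidem
    · exact ⟨y, hy, hxy⟩
  · obtain ⟨y, hy | hy, hxy⟩ := IterIdeal.exists_atom_sim hP hx
    · exact ⟨y, hy, hxy⟩
    · exact absurd (IterIdeal.isIdem_congr hxy hidem) (IterIdeal.not_isIdem_of_mem_idealsOf hy)
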